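/- **Setting.** Let $k$ be an infinite field. A simplicial complex is a downward closed family of subsets of a finite set (the void family is allowed, and $\emptyset$ is a face of dimension $-1$ of every non-void complex). A relative complex $\Psi=(\Delta,\Gamma)$ is a simplicial complex $\Delta$ with a subcomplex $\Gamma$; its faces are the elements of $\Delta\setminus\Gamma$, and it is pure of dimension $d$ if it has a face and all its inclusion-maximal faces have dimension $d$. For $\tau\in\Delta$ put $\mathrm{st}_\tau\Delta=\{\rho\in\Delta: \tau\cup\rho\in\Delta\}$, $\mathrm{st}_\tau\Gamma=\{\rho\in\Gamma:\tau\cup\rho\in\Gamma\}$ and $\mathrm{st}_\tau\Psi=(\mathrm{st}_\tau\Delta,\mathrm{st}_\tau\Gamma)$. The face module is $k[\Psi]=I_\Gamma/I_\Delta$, where $I_\Delta$, $I_\Gamma$ are the ideals generated by the squarefree monomials of the non-faces; it is a graded module over the face ring $k[\Delta]=k[x_v]/I_\Delta$. $H^*(\Psi;k)$ is the simplicial cohomology of the pair $(\Delta,\Gamma)$, where $\emptyset$ counts as a face of dimension $-1$ (so it is reduced cohomology when $\Gamma$ is void). A finitely generated graded module $M$ is Cohen–Macaulay if some homogeneous system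 of parameters (a sequence of homogeneous elements of positive degree, of minimal length among those with $\dim_k M/\langle\theta\rangle M<\infty$) is a regular sequence on $M$; in particular $M\ne 0$. The partition complex $P^*=P^*(\Psi)$ is the complex of graded $k[\Delta]$-modules $$0\to P^{-1}=k[\Psi]\to\bigoplus_{v\in\Delta^{(0)}}k[\mathrm{st}_v\Psi]\to\cdots\to P^i=\bigoplus_{\tau\in\Delta,\ \dim\tau=i}k[\mathrm{st}_\tau\Psi]\to\cdots$$ whose differentials are the alternating (Čech) sums of the restriction maps $k[\mathrm{st}_\rho\Psi]\to k[\mathrm{st}_\tau\Psi]$ for $\rho\subset\tau$, $\dim\tau=\dim\rho+1$. **Theorem (partition of unity).** Let $\Psi=(\Delta,\Gamma)$ be a relative complex, pure of dimension $d$, such that $k[\mathrm{st}_\tau\Psi]$ is Cohen–Macaulay for every nonempty $\tau\in\Delta$ (a Buchsbaum complex). Then for a generic sequence $\Theta=(\theta_1,\dots,\theta_{d+1})$ of $d+1$ elements of $k[\Delta]_1$, that is, for all $\Theta$ in a nonempty Zariski open subset of $(k[\Delta]_1)^{d+1}$, the degree $j$ pieces of the homology of the reduced partition complex $P^*/\langle\Theta\rangle$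 satisfy $$\dim_k H^i(P^*/\langle\Theta\rangle)_j=\binom{d+1}{j}\cdot\dim_k H^{i+j}(\Psi;k)\qquad\text{for all } i\ge -1,\ j\ge 0.$$ In particular, for all $j\ge 0$, $$\dim_k\ker\Big(k[\Psi]/\langle\Theta\rangle\to\bigoplus_{v\in\Delta^{(0)}}k[\mathrm{st}_v\Psi]/\langle\Theta\rangle\Big)_j=\binom{d+1}{j}\cdot\dim_k H^{j-1}(\Psi;k).$$ -/

import Mathlib

open MvPolynomial

noncomputable section

namespace PartitionOfUnity

universe u w

/-! ### Relative simplicial complexes -/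

/-- A relative simplicial complex `Ψ = (Δ, Γ)` on the ground set `V`: a simplicial complex `Δ`
(a downward closed family of finite sets, so `∅` is a face as soon as there is a face, and the void
family is allowed) together with a subcomplex `Γ`. -/
structure RelativeComplex (V : Type u) where
  /-- The ambient complex. -/
  Δ : LowerSet (Finset V)
  /-- The subcomplex. -/
  Γ : LowerSet (Finset V)
  /-- `Γ` is contained in `Δ`. -/
  le : Γ ≤ Δ

/-- The star of `τ` in a simplicial complex: the faces `ρ` such that `τ ∪ ρ` is a face. -/
def starComplex {V : Type u} [DecidableEq V] (D : LowerSet (Finset V)) (τ : Finset V) :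
    LowerSet (Finset V) where
  carrier := {ρ | ρ ∈ D ∧ τ ∪ ρ ∈ D}
  lower' := fun _ _ hab ha => ⟨D.lower hab ha.1, D.lower (Finset.union_subset_union_right hab) ha.2⟩

theorem starComplex_antitone {V : Type u} [DecidableEq V] (D : LowerSet (Finset V))
    {ρ τ : Finset V} (h : ρ ⊆ τ) : starComplex D τ ≤ starComplex D ρ :=
  fun _ hx => ⟨hx.1, D.lower (Finset.union_subset_union_left h) hx.2⟩

theorem starComplex_le {V : Type u} [DecidableEq V] (D : LowerSet (Finset V))
    (τ : Finset V) : starComplex D τ ≤ D :=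
  fun _ hx => hx.1

namespace RelativeComplex

variable {V : Type u}

/-- The faces of `Ψ = (Δ, Γ)` are the faces of `Δ` that are not faces of `Γ`. -/
def IsFace (Ψ : RelativeComplex V) (σ : Finset V) : Prop := σ ∈ Ψ.Δ ∧ σ ∉ Ψ.Γ

/-- `Ψ` is pure of dimension `d`: it has a face, and all its (inclusion-)maximal faces have
dimension `d`, where `dim σ = |σ| - 1`. -/
def IsPureOfDim (Ψ : RelativeComplex V) (d : ℤ) : Prop :=
  (∃ σ, Ψ.IsFace σ) ∧ ∀ σ, Maximal Ψ.IsFace σ → (σ.card : ℤ) - 1 = d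

/-- The star of `τ` within `Ψ`, that is `(st_τ Δ, st_τ Γ)`. -/
def star [DecidableEq V] (Ψ : RelativeComplex V) (τ : Finset V) : RelativeComplex V where
  Δ := starComplex Ψ.Δ τ
  Γ := starComplex Ψ.Γ τ
  le := fun _ hx => ⟨Ψ.le hx.1, Ψ.le hx.2⟩

theorem star_Δ_le [DecidableEq V] (Ψ : RelativeComplex V) {ρ τ : Finset V} (h : ρ ⊆ τ) :
    (Ψ.star τ).Δ ≤ (Ψ.star ρ).Δ :=
  starComplex_antitone Ψ.Δ h

theorem star_Γ_le [DecidableEq V] (Ψ : RelativeComplex V) {ρ τ : Finset V} (h : ρ ⊆ τ) :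
    (Ψ.star τ).Γ ≤ (Ψ.star ρ).Γ :=
  starComplex_antitone Ψ.Γ h

theorem star_Δ_le_self [DecidableEq V] (Ψ : RelativeComplex V) (τ : Finset V) :
    (Ψ.star τ).Δ ≤ Ψ.Δ :=
  starComplex_le Ψ.Δ τ

theorem star_Γ_le_self [DecidableEq V] (Ψ : RelativeComplex V) (τ : Finset V) :
    (Ψ.star τ).Γ ≤ Ψ.Γ :=
  starComplex_le Ψ.Γ τ

/-- The vertices of `Δ`. -/
abbrev Vertex (Ψ : RelativeComplex V) : Type u := {v : V // ({v} : Finset V) ∈ Ψ.Δ}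

/-- The faces of `Δ` of dimension `i`. -/
abbrev AmbientFace (Ψ : RelativeComplex V) (i : ℤ) : Type u :=
  {τ : Finset V // τ ∈ Ψ.Δ ∧ (τ.card : ℤ) - 1 = i}

/-- The faces of `Ψ` of dimension `i`. -/
abbrev Face (Ψ : RelativeComplex V) (i : ℤ) : Type u :=
  {τ : Finset V // Ψ.IsFace τ ∧ (τ.card : ℤ) - 1 = i}

end RelativeComplex

/-- Removing a vertex lowers the dimension of a simplex by one. -/
theorem dim_erase {V : Type u} [DecidableEq V] {τ : Finset V} {v : V} (hv : v ∈ τ) {p q : ℤ}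
    (h : q = p + 1) (hτ : (τ.card : ℤ) - 1 = q) : ((τ.erase v).card : ℤ) - 1 = p := by
  have := Finset.card_erase_add_one hv
  omega

/-- The sign `(-1)^j`, where `v` is the `j`-th vertex of `τ`, counted from `0`. -/
def vertexSign {V : Type u} [LinearOrder V] (τ : Finset V) (v : V) : ℤ :=
  (-1) ^ (τ.filter (· < v)).card

/-! ### Homology of linear maps and its graded pieces -/

section Homology

variable {R A B C : Type*} [Ring R] [AddCommGroup A] [AddCommGroup B] [AddCommGroup C]
  [Module R A] [Module R B] [Module R C]

/-- The homology `ker g / im f` at the middle term of `A → B → C`. -/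
abbrev Homology (f : A →ₗ[R] B) (g : B →ₗ[R] C) : Type _ :=
  LinearMap.ker g ⧸ (LinearMap.range f).submoduleOf (LinearMap.ker g)

/-- The part of the homology `ker g / im f` that is represented by the cycles in a subspace `W` of
the middle term. For `W` the `j`-th graded piece of `B` this is the `j`-th graded piece of the
homology. -/
def homologyPiece (k : Type*) [CommRing k] [SMul k R] [Module k B] [IsScalarTower k R B]
    (f : A →ₗ[R] B) (g : B →ₗ[R] C) (W : Submodule k B) : Submodule k (Homology f g) :=
  (W.comap ((LinearMap.ker g).subtype.restrictScalars k)).map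
    (((LinearMap.range f).submoduleOf (LinearMap.ker g)).mkQ.restrictScalars k)

end Homology

/-! ### Cohomology of a relative complex -/

section Cohomology

variable (k : Type w) [Field k] {V : Type u} [LinearOrder V]

open scoped Classical in
/-- The simplicial coboundary of the pair `(Δ, Γ)`. A cochain of degree `p` is a function on the
`p`-faces of `Δ` that vanishes on `Γ`, that is, a function on the `p`-faces of `Ψ`; the empty set is
a face of dimension `-1` if it is a face of `Ψ`. -/
def coboundary (Ψ : RelativeComplex V) {p q : ℤ} (h : q = p + 1) :
    (Ψ.Face p → k) →ₗ[k] (Ψ.Face q → k) :=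
  LinearMap.pi fun τ => ∑ v : {v // v ∈ τ.1},
    if hv : τ.1.erase v ∈ Ψ.Γ then 0
    else vertexSign τ.1 v.1 • LinearMap.proj (⟨τ.1.erase v,
      ⟨Ψ.Δ.lower (Finset.erase_subset _ _) τ.2.1.1, hv⟩, dim_erase v.2 h τ.2.2⟩ : Ψ.Face p)

/-- The simplicial cohomology `H^i(Ψ; k)` of the pair `(Δ, Γ)`; for void `Γ` it is the reduced
cohomology of `Δ`. -/
abbrev Cohomology (Ψ : RelativeComplex V) (i : ℤ) : Type _ :=
  Homology (coboundary k Ψ (sub_add_cancel i 1).symm) (coboundary k Ψ (rfl : i + 1 = i + 1))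

end Cohomology

/-! ### Face modules -/

section FaceModule

variable (k : Type w) [Field k] {V : Type u}

/-- The non-face ideal `I_D`, in the polynomial ring on the ground set. It contains the variable of
each point of the ground set that is not a vertex of `D`, so that the quotient by it is the face
ring `k[D]` also when `D` does not use the whole ground set. -/
def nonfaceIdeal (D : LowerSet (Finset V)) : Ideal (MvPolynomial V k) :=
  Ideal.span {m | ∃ σ : Finset V, σ ∉ D ∧ m = ∏ v ∈ σ, X v}

theorem nonfaceIdeal_antitone {D E : LowerSet (Finset V)} (h : D ≤ E) :
    nonfaceIdeal k E ≤ nonfaceIdeal k D :=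
  Ideal.span_mono fun _ ⟨σ, hσ, hm⟩ => ⟨σ, fun hD => hσ (h hD), hm⟩

/-- The relative face module `k[Ψ] = I_Γ / I_Δ`. It is a module over the polynomial ring, which acts
through the face ring `k[Δ]`. -/
def FaceModule (Ψ : RelativeComplex V) : Type _ :=
  nonfaceIdeal k Ψ.Γ ⧸ (nonfaceIdeal k Ψ.Δ).submoduleOf (nonfaceIdeal k Ψ.Γ)

instance (Ψ : RelativeComplex V) : AddCommGroup (FaceModule k Ψ) :=
  inferInstanceAs (AddCommGroup
    (nonfaceIdeal k Ψ.Γ ⧸ (nonfaceIdeal k Ψ.Δ).submoduleOf (nonfaceIdeal k Ψ.Γ)))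

instance (Ψ : RelativeComplex V) : Module (MvPolynomial V k) (FaceModule k Ψ) :=
  inferInstanceAs (Module (MvPolynomial V k)
    (nonfaceIdeal k Ψ.Γ ⧸ (nonfaceIdeal k Ψ.Δ).submoduleOf (nonfaceIdeal k Ψ.Γ)))

instance (Ψ : RelativeComplex V) : Module k (FaceModule k Ψ) :=
  inferInstanceAs (Module k
    (nonfaceIdeal k Ψ.Γ ⧸ (nonfaceIdeal k Ψ.Δ).submoduleOf (nonfaceIdeal k Ψ.Γ)))

instance (Ψ : RelativeComplex V) : IsScalarTower k (MvPolynomial V k) (FaceModule k Ψ) :=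
  inferInstanceAs (IsScalarTower k (MvPolynomial V k)
    (nonfaceIdeal k Ψ.Γ ⧸ (nonfaceIdeal k Ψ.Δ).submoduleOf (nonfaceIdeal k Ψ.Γ)))

/-- The quotient map `I_Γ → I_Γ / I_Δ = k[Ψ]`. -/
def toFaceModule (Ψ : RelativeComplex V) :
    nonfaceIdeal k Ψ.Γ →ₗ[MvPolynomial V k] FaceModule k Ψ :=
  ((nonfaceIdeal k Ψ.Δ).submoduleOf (nonfaceIdeal k Ψ.Γ)).mkQ

/-- The piece of degree `j` of `k[Ψ]`. -/
def faceModulePiece (Ψ : RelativeComplex V) (j : ℕ) : Submodule k (FaceModule k Ψ) :=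
  ((homogeneousSubmodule V k j).comap ((nonfaceIdeal k Ψ.Γ).subtype.restrictScalars k)).map
    ((toFaceModule k Ψ).restrictScalars k)

/-- The map `k[Ψ] → k[Ψ']`, for `Δ' ⊆ Δ` and `Γ' ⊆ Γ`, that is induced by the identity of the
polynomial ring. -/
def restrictFaceModule {Ψ Ψ' : RelativeComplex V} (hΔ : Ψ'.Δ ≤ Ψ.Δ) (hΓ : Ψ'.Γ ≤ Ψ.Γ) :
    FaceModule k Ψ →ₗ[MvPolynomial V k] FaceModule k Ψ' :=
  Submodule.mapQ ((nonfaceIdeal k Ψ.Δ).submoduleOf (nonfaceIdeal k Ψ.Γ))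
    ((nonfaceIdeal k Ψ'.Δ).submoduleOf (nonfaceIdeal k Ψ'.Γ))
    (Submodule.inclusion (nonfaceIdeal_antitone k hΓ))
    fun _ hx => nonfaceIdeal_antitone k hΔ hx

end FaceModule

/-! ### The Cohen-Macaulay property -/

section CohenMacaulay

variable (k : Type w) [Field k] {V : Type u} (M : Type*) [AddCommGroup M]
  [Module (MvPolynomial V k) M] [Module k M] [IsScalarTower k (MvPolynomial V k) M]

/-- The entries of `θ` are homogeneous of positive degree and `M / ⟨θ⟩ M` is finite dimensional. -/
def HasFiniteQuotient (θ : List (MvPolynomial V k)) : Prop :=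
  (∀ f ∈ θ, ∃ m : ℕ, 0 < m ∧ f.IsHomogeneous m) ∧
    Module.Finite k (M ⧸ (Ideal.ofList θ • (⊤ : Submodule (MvPolynomial V k) M)))

/-- A homogeneous system of parameters for `M`: a sequence of homogeneous elements of positive
degree, of minimal length among those for which `M / ⟨θ⟩ M` is finite dimensional. -/
def IsHomogeneousSOP (θ : List (MvPolynomial V k)) : Prop :=
  HasFiniteQuotient k M θ ∧
    ∀ η : List (MvPolynomial V k), HasFiniteQuotient k M η → θ.length ≤ η.length

/-- `M` is Cohen-Macaulay: some homogeneous system of parameters for `M` is an `M`-sequence. -/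
def IsCohenMacaulay : Prop :=
  ∃ θ : List (MvPolynomial V k), IsHomogeneousSOP k M θ ∧ RingTheory.Sequence.IsRegular M θ

end CohenMacaulay

/-! ### Generic sequences of linear forms -/

/-- A property of the points of the affine space `k^ι` over an infinite field holds generically: it
holds on a nonempty (equivalently, dense) Zariski open subset. Such a subset can be taken to be the
set where some nonzero polynomial `F` does not vanish. -/
def HoldsGenerically {k : Type w} [Field k] {ι : Type u} (P : (ι → k) → Prop) : Prop :=
  ∃ F : MvPolynomial ι k, F ≠ 0 ∧ ∀ c : ι → k, eval c F ≠ 0 → P c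

open scoped Classical in
/-- The ideal `⟨Θ⟩` for the sequence `Θ` of the `n` linear forms `θ_t = ∑_v c (t, v) x_v`, the sum
over the vertices `v` of `Δ`. The variables of the vertices are a basis of `k[Δ]_1`, so `c` runs
through the coordinate vectors of all sequences in `k[Δ]_1` of length `n`. -/
def linearFormsIdeal {k : Type w} [Field k] {V : Type u} [Fintype V] (Ψ : RelativeComplex V) {n : ℕ}
    (c : Fin n × Ψ.Vertex → k) : Ideal (MvPolynomial V k) :=
  Ideal.span (Set.range fun t : Fin n => ∑ v : Ψ.Vertex, C (c (t, v)) * X v.1)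

/-! ### The partition complex -/

section Partition

variable (k : Type w) [Field k] {V : Type u} [LinearOrder V] (Ψ : RelativeComplex V)

/-- The term `P^i` of the partition complex, the sum of `k[st_τ Ψ]` over the `i`-dimensional faces
`τ` of `Δ`. As `st_∅ Ψ = Ψ`, the term `P^{-1}` is `k[Ψ]`. -/
abbrev PartitionTerm (i : ℤ) : Type _ :=
  ∀ τ : Ψ.AmbientFace i, FaceModule k (Ψ.star τ.1)

/-- The piece of degree `j` of `P^i`. -/
def partitionPiece (i : ℤ) (j : ℕ) : Submodule k (PartitionTerm k Ψ i) :=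
  Submodule.pi Set.univ fun τ => faceModulePiece k (Ψ.star τ.1) j

/-- The differential of the partition complex: on the summand of `ρ` it is the sum over the faces
`τ = ρ ∪ {v}` of the restrictions `k[st_ρ Ψ] → k[st_τ Ψ]`, with signs. -/
def partitionD {p q : ℤ} (h : q = p + 1) :
    PartitionTerm k Ψ p →ₗ[MvPolynomial V k] PartitionTerm k Ψ q :=
  LinearMap.pi fun τ => ∑ v : {v // v ∈ τ.1}, vertexSign τ.1 v.1 •
    (restrictFaceModule k (Ψ := Ψ.star (τ.1.erase v)) (Ψ' := Ψ.star τ.1)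
      (Ψ.star_Δ_le (Finset.erase_subset _ _))
      (Ψ.star_Γ_le (Finset.erase_subset _ _))).comp
    (LinearMap.proj (⟨τ.1.erase v, Ψ.Δ.lower (Finset.erase_subset _ _) τ.2.1,
      dim_erase v.2 h τ.2.2⟩ : Ψ.AmbientFace p))

end Partition

/-! ### Reduction modulo an ideal -/

section Reduction

variable {R M N : Type*} [CommRing R] [AddCommGroup M] [Module R M] [AddCommGroup N] [Module R N]

/-- The quotient `M / J M`. -/
abbrev Reduced (J : Ideal R) (M : Type*) [AddCommGroup M] [Module R M] : Type _ :=
  M ⧸ (J • (⊤ : Submodule R M))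

/-- The map `M / J M → N / J N` induced by a linear map. -/
def reducedMap (J : Ideal R) (f : M →ₗ[R] N) : Reduced J M →ₗ[R] Reduced J N :=
  Submodule.mapQ _ _ f (Submodule.smul_top_le_comap_smul_top J f)

/-- The image in `M / J M` of a subspace of `M`. For a graded piece of `M` and homogeneous `J` this
is the graded piece of `M / J M`. -/
def reducedPiece {k : Type*} [CommRing k] [Algebra k R] [Module k M] [IsScalarTower k R M]
    (J : Ideal R) (W : Submodule k M) : Submodule k (Reduced J M) :=
  W.map ((J • (⊤ : Submodule R M)).mkQ.restrictScalars k)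

end Reduction

section ReducedPartition

variable {k : Type w} [Field k] {V : Type u} [LinearOrder V] (Ψ : RelativeComplex V)
  (J : Ideal (MvPolynomial V k))

/-- The differential of `P^* / J P^*`, where `P^*` is the partition complex. -/
def reducedPartitionD {p q : ℤ} (h : q = p + 1) :
    Reduced J (PartitionTerm k Ψ p) →ₗ[MvPolynomial V k] Reduced J (PartitionTerm k Ψ q) :=
  reducedMap (M := PartitionTerm k Ψ p) (N := PartitionTerm k Ψ q) J (partitionD k Ψ h)

/-- The homology `H^i(P^* / J P^*)`. -/
abbrev ReducedPartitionHomology (i : ℤ) : Type _ :=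
  Homology (reducedPartitionD Ψ J (sub_add_cancel i 1).symm)
    (reducedPartitionD Ψ J (rfl : i + 1 = i + 1))

/-- The piece of degree `j` of `H^i(P^* / J P^*)`. -/
def reducedPartitionHomologyPiece (i : ℤ) (j : ℕ) :
    Submodule k (ReducedPartitionHomology Ψ J i) :=
  homologyPiece k _ _ (reducedPiece J (partitionPiece k Ψ i j))

/-- The restriction map `k[Ψ] / J → ⊕_v k[st_v Ψ] / J`, over the vertices `v` of `Δ`. -/
def vertexStarMap : Reduced J (FaceModule k Ψ) →ₗ[MvPolynomial V k]
    (∀ v : Ψ.Vertex, Reduced J (FaceModule k (Ψ.star {v.1}))) :=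
  LinearMap.pi fun v => reducedMap J (restrictFaceModule k (Ψ := Ψ) (Ψ' := Ψ.star {v.1})
    (Ψ.star_Δ_le_self _) (Ψ.star_Γ_le_self _))

/-- The piece of degree `j` of the kernel of `k[Ψ] / J → ⊕_v k[st_v Ψ] / J`. -/
def vertexStarKernel (j : ℕ) : Submodule k (Reduced J (FaceModule k Ψ)) :=
  (LinearMap.ker (vertexStarMap Ψ J)).restrictScalars k ⊓
    reducedPiece J (faceModulePiece k Ψ j)

end ReducedPartition

end PartitionOfUnity

end

open PartitionOfUnity

noncomputable section

namespace PartitionOfUnity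

universe u w

/-! ### Homogeneous parameters and regular sequences -/

section Regular

open RingTheory.Sequence Pointwise

attribute [local instance] MvPolynomial.gradedAlgebra

variable {k : Type w} [Field k] {V : Type u}

/-! Two families of homotopies and one dimension count carry the proof. Elements of `P^*` are
represented by families of polynomials indexed by all finite sets, so `P^*` can borrow the cone
operators of the full simplex. Coning with apex `v` leads from the star of `τ ∪ {v}` back to the
star of `τ`, against the restriction maps; it becomes well defined after composition with an
endomorphism `g` of the polynomial ring that forces `v` into every support (`RaisesSupport`). Then
`g` is null-homotopic on `P^*`. If `g` is multiplication by `x_v`, the homotopy is linear over the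
polynomial ring, so every form of positive degree kills the homology of `P^*/JP^*` for every ideal
`J` (`smul_mem_of_partitionD_mem`). If `g` is the projection to the monomials with least variable
`x_v`, the sum over `v` is the identity in positive degrees, so `P^*` itself is exact there
(`mem_range_partitionD`). In degree zero `P^*` is the cochain complex of `Ψ` (`cochainMap`).

The linear forms are now divided out one at a time. Let `J` be generated by the earlier forms and
let `θ` be the next one. It acts injectively on `P^p/JP^p` for `p ≥ 0` and as zero on homology, so
the sequence for multiplication by `θ` yields `h^i_{j+1}(J + θ) = h^i_{j+1}(J) + h^{i+1}_j(J)`,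
where `h^i_j` is the dimension of the degree `j` piece of `H^i`. Injectivity may fail on `P^{-1} =
k[Ψ]`; the count in `IsGradedOn.finrank_cyclesMod_sup` needs it only in cohomological degrees `i +
1` and `i + 2`. Pascal's rule gives the binomial coefficients, and `i + j` is the same in both
summands.

It remains to make one generic sequence regular on `k[st_τ Ψ]` for all nonempty `τ`. Genericity
means that the coefficient minors of all faces with `n = d + 1` vertices are nonzero. By Stanley's
criterion the forms then generate the irrelevant ideal up to radical in each `k[st_τ Δ]`. The
Cohen–Macaulay hypothesis supplies some regular system of parameters, and an exchange argument
transfers regularity to the linear forms (`GradedSeparated.isWeaklyRegular_of_X_mem_radical`). -/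

/-- A polynomial that is homogeneous of some positive degree. -/
def IsPosHomogeneous (f : MvPolynomial V k) : Prop := ∃ m : ℕ, 0 < m ∧ f.IsHomogeneous m

theorem IsPosHomogeneous.constantCoeff_eq_zero {f : MvPolynomial V k} (hf : IsPosHomogeneous f) :
    constantCoeff f = 0 := by
  obtain ⟨m, hm, h⟩ := hf
  by_contra hne
  have := h hne
  simp at this
  omega

theorem IsPosHomogeneous.isHomogeneousElem {f : MvPolynomial V k} (hf : IsPosHomogeneous f) :
    SetLike.IsHomogeneousElem (homogeneousSubmodule V k) f := by
  obtain ⟨m, -, h⟩ := hf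
  exact ⟨m, h⟩

theorem isHomogeneous_ofList {rs : List (MvPolynomial V k)} (h : ∀ f ∈ rs, IsPosHomogeneous f) :
    (Ideal.ofList rs).IsHomogeneous (homogeneousSubmodule V k) :=
  Ideal.homogeneous_span _ _ fun x hx => (h x hx).isHomogeneousElem

/-- If a linear form avoids each of finitely many linear subspaces separately, then some linear form
avoids all of them at once. -/
theorem exists_isPosHomogeneous_forall_notMem [Infinite k] [Fintype V]
    {T : Set (Ideal (MvPolynomial V k))} (hT : T.Finite)
    (h : ∀ P ∈ T, ∃ v, (X v : MvPolynomial V k) ∉ P) :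
    ∃ ψ : MvPolynomial V k, IsPosHomogeneous ψ ∧ ∀ P ∈ T, ψ ∉ P := by
  classical
  let L : (V → k) →ₗ[k] MvPolynomial V k := ∑ v, (LinearMap.proj v).smulRight (X v)
  have hL : ∀ c, L c = ∑ v, c v • X v := fun c => by simp [L]
  by_contra hcon
  push Not at hcon
  have := hT.to_subtype
  let p : T → Subspace k (V → k) := fun P => (P.1.restrictScalars k).comap L
  have hun : ⋃ P, (p P : Set (V → k)) = Set.univ := by
    refine Set.eq_univ_of_forall fun c => ?_
    obtain ⟨P, hP, hm⟩ := hcon (L c) ⟨1, one_pos, by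
      rw [hL]
      exact IsHomogeneous.sum _ _ _ fun v _ => (homogeneousSubmodule V k 1).smul_mem _
        (isHomogeneous_X k v)⟩
    exact Set.mem_iUnion.2 ⟨⟨P, hP⟩, hm⟩
  obtain ⟨P, hP⟩ := Subspace.exists_eq_top_of_iUnion_eq_univ hun
  obtain ⟨v, hv⟩ := h P.1 P.2
  apply hv
  have : Pi.single v (1 : k) ∈ p P := hP ▸ Submodule.mem_top
  have h2 : L (Pi.single v 1) ∈ P.1 := this
  rw [hL] at h2
  simpa [Pi.single_apply] using h2

theorem ker_constantCoeff_le {P : Ideal (MvPolynomial V k)} (h : ∀ v, X v ∈ P) :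
    RingHom.ker (constantCoeff : MvPolynomial V k →+* k) ≤ P := by
  intro f hf
  have h2 : f ∈ Ideal.span (X '' (Set.univ : Set V) : Set (MvPolynomial V k)) := by
    rw [mem_ideal_span_X_image]
    intro m hm
    by_contra! hcon
    have : m = 0 := Finsupp.ext fun v => hcon v trivial
    exact mem_support_iff.1 hm (this ▸ hf)
  exact (Ideal.span_le.2 (by rintro _ ⟨v, -, rfl⟩; exact h v)) h2

theorem le_ker_constantCoeff {P : Ideal (MvPolynomial V k)} (hne : P ≠ ⊤)
    (hP : P.IsHomogeneous (homogeneousSubmodule V k)) :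
    P ≤ RingHom.ker (constantCoeff : MvPolynomial V k →+* k) := by
  intro f hf
  by_contra hf0
  apply hne
  have h0 := homogeneousComponent_mem_of_mem hP hf 0
  rw [homogeneousComponent_zero] at h0
  exact P.eq_top_of_isUnit_mem h0 ((IsUnit.mk0 _ hf0).map C)

/-- A homogeneous element outside all the minimal primes of a homogeneous ideal, except possibly the
irrelevant ideal, can replace any other element in a homogeneous system of parameters. -/
theorem X_mem_radical_of_notMem_minimalPrimes [Finite V] {I : Ideal (MvPolynomial V k)}
    (hI : I.IsHomogeneous (homogeneousSubmodule V k)) {φ ψ : MvPolynomial V k}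
    (hφ : IsPosHomogeneous φ) (hψ : IsPosHomogeneous ψ)
    (h : ∀ v, X v ∈ (I ⊔ Ideal.span {φ}).radical)
    (hmin : ∀ Q ∈ I.minimalPrimes, (∃ v, X v ∉ Q) → ψ ∉ Q) (v : V) :
    X v ∈ (I ⊔ Ideal.span {ψ}).radical := by
  classical
  have hJ : (I ⊔ Ideal.span {ψ}).IsHomogeneous (homogeneousSubmodule V k) :=
    hI.sup (Ideal.homogeneous_span _ _ fun x hx => by
      rw [Set.mem_singleton_iff.1 hx]; exact hψ.isHomogeneousElem)
  rw [Ideal.radical_eq_sInf, Ideal.mem_sInf]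
  rintro P₀ ⟨hJP, hP₀⟩
  -- The homogeneous core of a prime over a homogeneous ideal is again a prime over it, so the
  -- radical may be tested on homogeneous primes; these lie in the irrelevant ideal.
  set P := (P₀.homogeneousCore (homogeneousSubmodule V k)).toIdeal with hPdef
  have hP : P.IsPrime := hP₀.homogeneousCore
  have hPP : P ≤ P₀ := Ideal.toIdeal_homogeneousCore_le _ _
  have hJP' : I ⊔ Ideal.span {ψ} ≤ P := by
    rw [← hJ.toIdeal_homogeneousCore_eq_self]
    exact Ideal.homogeneousCore_mono _ hJP
  apply hPP
  by_contra hv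
  obtain ⟨Q, hQ, hQP⟩ := Ideal.exists_minimalPrimes_le (le_sup_left.trans hJP')
  have hQprime : Q.IsPrime := hQ.1.1
  have hψP : ψ ∈ P := hJP' (Ideal.mem_sup_right (Ideal.mem_span_singleton_self ψ))
  have hψQ := hmin Q hQ ⟨v, fun hvQ => hv (hQP hvQ)⟩
  have hlt1 : Q < P := lt_of_le_of_ne hQP fun e => hψQ (e ▸ hψP)
  set 𝔪 := RingHom.ker (constantCoeff : MvPolynomial V k →+* k) with h𝔪
  have hm : 𝔪.IsPrime := RingHom.ker_isPrime _
  have hPm : P ≤ 𝔪 := le_ker_constantCoeff hP.ne_top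
    (P₀.homogeneousCore (homogeneousSubmodule V k)).isHomogeneous
  have hlt2 : P < 𝔪 := lt_of_le_of_ne hPm fun e => hv (e ▸ by simp [h𝔪, RingHom.mem_ker])
  -- Modulo `Q`, the irrelevant ideal is minimal over the single element `φ`, so Krull's principal
  -- ideal theorem bounds its height by one. The chain `Q < P < 𝔪` has length two.
  have hmmin : 𝔪 ∈ (Q ⊔ Ideal.span {φ}).minimalPrimes := by
    refine ⟨⟨hm, sup_le (hlt1.trans hlt2).le ?_⟩, ?_⟩
    · rw [Ideal.span_singleton_le_iff_mem]
      exact hφ.constantCoeff_eq_zero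
    · rintro P' ⟨hP', hle⟩ -
      refine ker_constantCoeff_le fun u => ?_
      exact hP'.radical_le_iff.2 ((sup_le_sup_right hQ.1.2 _).trans hle) (h u)
  have h1 := Ideal.map_height_le_one_of_mem_minimalPrimes hmmin
  have hker : RingHom.ker (Ideal.Quotient.mk Q) = Q := Ideal.mk_ker
  have hsur := Ideal.Quotient.mk_surjective (I := Q)
  have hP1 : (P.map (Ideal.Quotient.mk Q)).IsPrime :=
    Ideal.map_isPrime_of_surjective hsur (hker.le.trans hlt1.le)
  have hm1 : (𝔪.map (Ideal.Quotient.mk Q)).IsPrime :=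
    Ideal.map_isPrime_of_surjective hsur (hker.le.trans (hlt1.trans hlt2).le)
  have hcomap : ∀ {A : Ideal (MvPolynomial V k)}, Q ≤ A →
      (A.map (Ideal.Quotient.mk Q)).comap (Ideal.Quotient.mk Q) = A := fun {A} hA => by
    rw [Ideal.comap_map_of_surjective _ hsur]
    exact sup_eq_left.2 ((hker.le).trans hA)
  have hl1 : (⊥ : Ideal (MvPolynomial V k ⧸ Q)) < P.map (Ideal.Quotient.mk Q) := by
    refine bot_lt_iff_ne_bot.2 fun e => hlt1.ne ?_
    have := hcomap hlt1.le
    rw [e] at this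
    rw [← this]
    exact hker.symm
  have hl2 : P.map (Ideal.Quotient.mk Q) < 𝔪.map (Ideal.Quotient.mk Q) := by
    refine lt_of_le_of_ne (Ideal.map_mono hlt2.le) fun e => hlt2.ne ?_
    rw [← hcomap hlt1.le, e, hcomap (hlt1.trans hlt2).le]
  have a1 := Ideal.height_add_one_le_of_lt_of_isPrime hl1
  have a2 := Ideal.height_add_one_le_of_lt_of_isPrime hl2
  have : (1 : ℕ∞) + 1 ≤ 1 := by
    calc (1 : ℕ∞) + 1 ≤ ((⊥ : Ideal (MvPolynomial V k ⧸ Q)).height + 1) + 1 := by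
          gcongr; exact le_add_self
      _ ≤ _ := by gcongr
      _ ≤ _ := a2
      _ ≤ 1 := h1
  exact absurd this (by decide)

variable (k V) in
/-- A property of graded modules that is used in the place of a grading: homogeneous submodules of
the form `J M` are closed for the topology of the irrelevant ideal, in a strong sense. -/
def GradedSeparated (M : Type*) [AddCommGroup M] [Module (MvPolynomial V k) M] : Prop :=
  ∀ rs : List (MvPolynomial V k), (∀ f ∈ rs, IsPosHomogeneous f) →
    ∀ r : MvPolynomial V k, constantCoeff r = 0 → ∀ x : M,
      x - r • x ∈ (Ideal.ofList rs • ⊤ : Submodule (MvPolynomial V k) M) →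
      x ∈ (Ideal.ofList rs • ⊤ : Submodule (MvPolynomial V k) M)

variable {M : Type*} [AddCommGroup M] [Module (MvPolynomial V k) M]

theorem mem_ofList_smul_top_iff {R N : Type*} [CommRing R] [AddCommGroup N] [Module R N]
    (r : R) (rs : List R) (x : N) :
    Submodule.Quotient.mk x ∈ (Ideal.ofList rs • ⊤ : Submodule R (QuotSMulTop r N)) ↔
      x ∈ (Ideal.ofList (r :: rs) • ⊤ : Submodule R N) := by
  have h : (Ideal.ofList rs • ⊤ : Submodule R (QuotSMulTop r N)) =
      (Ideal.ofList rs • ⊤ : Submodule R N).map (r • (⊤ : Submodule R N)).mkQ := by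
    rw [Submodule.map_smul'', Submodule.map_top, Submodule.range_mkQ]
  rw [h, Ideal.ofList_cons_smul]
  constructor
  · rintro ⟨y, hy, hyx⟩
    have := (Submodule.Quotient.eq _).1 hyx
    rw [← neg_sub, Submodule.neg_mem_iff] at this
    have := Submodule.add_mem_sup this hy
    simpa using this
  · intro hx
    obtain ⟨a, ha, b, hb, rfl⟩ := Submodule.mem_sup.1 hx
    refine ⟨b, hb, ?_⟩
    rw [Submodule.mkQ_apply, Submodule.Quotient.eq]
    simpa using ha

theorem GradedSeparated.quotSMulTop (hM : GradedSeparated k V M) {y : MvPolynomial V k}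
    (hy : IsPosHomogeneous y) : GradedSeparated k V (QuotSMulTop y M) := by
  intro rs hrs r hr x hx
  obtain ⟨x, rfl⟩ := Submodule.Quotient.mk_surjective _ x
  rw [← Submodule.Quotient.mk_smul, ← Submodule.Quotient.mk_sub, mem_ofList_smul_top_iff] at hx
  rw [mem_ofList_smul_top_iff]
  exact hM _ (by simpa using ⟨hy, hrs⟩) r hr x hx

/-- The obstruction to swapping `a` and `b` is the `b`-torsion `K` of a quotient of `M`, when `K =
aK`. Nakayama gives `r ≡ 1` modulo `a` that kills `K`. Since `1 - r` has no constant term,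
`GradedSeparated` forces `K = 0`, as the local hypothesis does in the classical statement. -/
theorem GradedSeparated.isWeaklyRegular_perm [IsNoetherian (MvPolynomial V k) M]
    (hM : GradedSeparated k V M) {rs rs' : List (MvPolynomial V k)}
    (h : IsWeaklyRegular M rs) (hrs : ∀ f ∈ rs, IsPosHomogeneous f) (hp : rs.Perm rs') :
    IsWeaklyRegular M rs' := by
  refine h.prototype_perm hp fun a b rs₁ hsub => ?_
  intro K hK
  have hmem : ∀ f ∈ a :: b :: rs₁, IsPosHomogeneous f := fun f hf => hrs f (hsub.subset hf)
  obtain ⟨r, hr, hrK⟩ := Submodule.exists_sub_one_mem_and_smul_eq_zero_of_fg_of_le_smul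
    (Ideal.span {a}) K (IsNoetherian.noetherian K) (by
      rw [Submodule.ideal_span_singleton_smul]; exact hK.le)
  refine (Submodule.eq_bot_iff _).2 fun x hx => ?_
  have h0 := hrK x hx
  obtain ⟨x, rfl⟩ := Submodule.Quotient.mk_surjective _ x
  rw [Submodule.Quotient.mk_eq_zero]
  refine hM rs₁ (fun f hf => hmem f (by simp [hf])) (1 - r) ?_ x ?_
  · obtain ⟨c, hc⟩ := Ideal.mem_span_singleton'.1 hr
    have := (hmem a (by simp)).constantCoeff_eq_zero
    rw [← neg_sub, ← hc]
    simp [this]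
  · have : x - (1 - r) • x = r • x := by rw [sub_smul, one_smul]; abel
    rw [this, ← Submodule.Quotient.mk_eq_zero, Submodule.Quotient.mk_smul]
    exact h0

/-- Some power of `x` acts on `N / ⟨rs⟩N` as a multiple of `y`, because `I` and `rs` act as zero
there. Whatever `y` kills is therefore killed by a power of the regular element `x`. -/
theorem isWeaklyRegular_append_singleton_of_pow_mem {R N : Type*} [CommRing R] [AddCommGroup N]
    [Module R N] {rs : List R} {x y : R} {I : Ideal R} (hI : I ≤ Module.annihilator R N)
    (h : IsWeaklyRegular N (rs ++ [x])) (hx : x ∈ (I ⊔ Ideal.ofList (rs ++ [y])).radical) :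
    IsWeaklyRegular N (rs ++ [y]) := by
  rw [isWeaklyRegular_append_iff, isWeaklyRegular_singleton_iff] at h ⊢
  refine ⟨h.1, ?_⟩
  obtain ⟨p, hp⟩ := hx
  rw [Ideal.ofList_append, Ideal.ofList_singleton, ← sup_assoc] at hp
  obtain ⟨α, hα, β, hβ, hsum⟩ := Submodule.mem_sup.1 hp
  obtain ⟨γ, rfl⟩ := Ideal.mem_span_singleton'.1 hβ
  rw [isSMulRegular_iff_right_eq_zero_of_smul]
  intro q hq
  refine (isSMulRegular_iff_right_eq_zero_of_smul.1 (h.2.pow p)) q ?_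
  rw [← hsum, add_smul, mul_smul, hq, smul_zero, add_zero]
  obtain ⟨a, ha, b, hb, rfl⟩ := Submodule.mem_sup.1 hα
  obtain ⟨q, rfl⟩ := Submodule.Quotient.mk_surjective _ q
  rw [← Submodule.Quotient.mk_smul, Submodule.Quotient.mk_eq_zero, add_smul,
    Module.mem_annihilator.1 (hI ha), zero_add]
  exact Submodule.smul_mem_smul hb trivial

/-- If a graded module has a homogeneous system of parameters that is a regular sequence, then every
homogeneous system of parameters is a regular sequence. -/
theorem GradedSeparated.isWeaklyRegular_of_X_mem_radical [Infinite k] [Fintype V] (n : ℕ) :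
    ∀ {M : Type*} [AddCommGroup M] [Module (MvPolynomial V k) M]
      [Module.Finite (MvPolynomial V k) M]
      (_ : GradedSeparated k V M) {I : Ideal (MvPolynomial V k)}
      (_ : I.IsHomogeneous (homogeneousSubmodule V k))
      (_ : I ≤ Module.annihilator (MvPolynomial V k) M)
      {φ θ : List (MvPolynomial V k)} (_ : ∀ f ∈ φ, IsPosHomogeneous f)
      (_ : ∀ f ∈ θ, IsPosHomogeneous f) (_ : IsWeaklyRegular M φ)
      (_ : ∀ v, X v ∈ (I ⊔ Ideal.ofList φ).radical) (_ : ∀ v, X v ∈ (I ⊔ Ideal.ofList θ).radical)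
      (_ : θ.length = n) (_ : n ≤ φ.length), IsWeaklyRegular M θ := by
  induction n with
  | zero =>
    intro M _ _ _ _ I _ _ φ θ _ _ _ _ _ hn _
    rw [List.length_eq_zero_iff.1 hn]
    exact IsWeaklyRegular.nil _ _
  | succ n ih =>
    intro M _ _ _ hM I hIh hI φ θ hφ hθ hreg hradφ hradθ hn hle
    obtain rfl | ⟨φ', a, rfl⟩ := φ.eq_nil_or_concat'
    · simp at hle
    obtain rfl | ⟨θ', b, rfl⟩ := θ.eq_nil_or_concat'
    · simp at hn
    simp only [List.length_append, List.length_cons, List.length_nil, zero_add,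
      add_left_inj, add_le_add_iff_right] at hn hle
    have hφ' : ∀ f ∈ φ', IsPosHomogeneous f := fun f hf => hφ f (by simp [hf])
    have hθ' : ∀ f ∈ θ', IsPosHomogeneous f := fun f hf => hθ f (by simp [hf])
    have hI1 := hIh.sup (isHomogeneous_ofList hφ')
    have hI2 := hIh.sup (isHomogeneous_ofList hθ')
    -- A common `ψ` outside the minimal primes of both truncated ideals, the irrelevant ideal
    -- excepted, can replace the last entry of either list.
    have hfin : ({Q ∈ (I ⊔ Ideal.ofList φ').minimalPrimes ∪ (I ⊔ Ideal.ofList θ').minimalPrimes |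
        ∃ v, X v ∉ Q}).Finite :=
      (((Ideal.finite_minimalPrimes_of_isNoetherianRing _ _).union
        (Ideal.finite_minimalPrimes_of_isNoetherianRing _ _)).subset (Set.sep_subset _ _))
    obtain ⟨ψ, hψ, hψn⟩ := exists_isPosHomogeneous_forall_notMem hfin fun P hP => hP.2
    have e : ∀ (l : List (MvPolynomial V k)) c, I ⊔ Ideal.ofList (l ++ [c]) =
        (I ⊔ Ideal.ofList l) ⊔ Ideal.span {c} := fun l c => by
      rw [Ideal.ofList_append, Ideal.ofList_singleton, sup_assoc]
    have r1 : ∀ v, X v ∈ (I ⊔ Ideal.ofList (φ' ++ [ψ])).radical := by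
      rw [e] at hradφ ⊢
      exact X_mem_radical_of_notMem_minimalPrimes hI1 (hφ a (by simp)) hψ hradφ
        fun Q hQ hv => hψn Q ⟨Or.inl hQ, hv⟩
    have r2 : ∀ v, X v ∈ (I ⊔ Ideal.ofList (θ' ++ [ψ])).radical := by
      have := hradθ
      rw [e] at this ⊢
      exact X_mem_radical_of_notMem_minimalPrimes hI2 (hθ b (by simp)) hψ this
        fun Q hQ hv => hψn Q ⟨Or.inr hQ, hv⟩
    have mem_of : ∀ {J : Ideal (MvPolynomial V k)}, (∀ v, X v ∈ J.radical) →
        ∀ {f}, IsPosHomogeneous f → f ∈ J.radical := by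
      intro J hJ f hf
      exact ker_constantCoeff_le hJ hf.constantCoeff_eq_zero
    have hreg1 : IsWeaklyRegular M (φ' ++ [ψ]) :=
      isWeaklyRegular_append_singleton_of_pow_mem hI hreg (mem_of r1 (hφ a (by simp)))
    have hreg2 : IsWeaklyRegular M (ψ :: φ') :=
      hM.isWeaklyRegular_perm hreg1 (by simpa [or_imp, forall_and] using ⟨hφ', hψ⟩)
        (List.perm_append_singleton _ _)
    rw [isWeaklyRegular_cons_iff] at hreg2
    have hreg3 : IsWeaklyRegular (QuotSMulTop ψ M) θ' := by
      have e2 : ∀ l : List (MvPolynomial V k), (I ⊔ Ideal.span {ψ}) ⊔ Ideal.ofList l =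
          I ⊔ Ideal.ofList (l ++ [ψ]) := fun l => by
        rw [Ideal.ofList_append, Ideal.ofList_singleton, sup_assoc, sup_comm (Ideal.span {ψ})]
      -- Moving `ψ` into the annihilating ideal turns the radical conditions for `φ'` and `θ'` over
      -- `M / ψM` into those already proved for `φ' ++ [ψ]` and `θ' ++ [ψ]`.
      refine ih (hM.quotSMulTop hψ) (I := I ⊔ Ideal.span {ψ}) ?_ (sup_le ?_ ?_) hφ' hθ' hreg2.2
        (by rwa [e2]) (by rwa [e2]) hn hle
      · exact hIh.sup (Ideal.homogeneous_span _ _ fun x hx => by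
          rw [Set.mem_singleton_iff.1 hx]; exact hψ.isHomogeneousElem)
      · exact hI.trans (LinearMap.annihilator_le_of_surjective _ (Submodule.mkQ_surjective _))
      · rw [Ideal.span_singleton_le_iff_mem, Module.mem_annihilator]
        intro q
        obtain ⟨q, rfl⟩ := Submodule.Quotient.mk_surjective _ q
        rw [← Submodule.Quotient.mk_smul, Submodule.Quotient.mk_eq_zero]
        exact Submodule.smul_mem_pointwise_smul _ _ _ trivial
    have hreg4 : IsWeaklyRegular M (ψ :: θ') := .cons hreg2.1 hreg3
    have hreg5 : IsWeaklyRegular M (θ' ++ [ψ]) :=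
      hM.isWeaklyRegular_perm hreg4 (by simpa using ⟨hψ, hθ'⟩)
        (List.perm_append_singleton _ _).symm
    -- The exchange is undone: `ψ` lies in the radical generated by `θ' ++ [b]`, so `b` inherits
    -- regularity from `ψ`.
    exact isWeaklyRegular_append_singleton_of_pow_mem hI hreg5 (mem_of hradθ hψ)

end Regular

/-! ### Homogeneous components -/

section HomogeneousComponent

variable {k : Type w} [Field k] {V : Type u}

theorem homogeneousComponent_add_mul {r : MvPolynomial V k} {a : ℕ} (hr : r.IsHomogeneous a) (b : ℕ)
    (f : MvPolynomial V k) :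
    homogeneousComponent (a + b) (r * f) = r * homogeneousComponent b f := by
  induction f using MvPolynomial.induction_on' with
  | monomial d c =>
    rw [homogeneousComponent_of_mem (isHomogeneous_monomial c rfl),
      homogeneousComponent_of_mem (hr.mul (isHomogeneous_monomial c rfl))]
    simp only [add_right_inj]
    split_ifs <;> simp
  | add p q hp hq => simp only [mul_add, map_add, hp, hq]

theorem homogeneousComponent_mul_of_lt {r : MvPolynomial V k} {a : ℕ} (hr : r.IsHomogeneous a)
    {j : ℕ} (hj : j < a) (f : MvPolynomial V k) : homogeneousComponent j (r * f) = 0 := by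
  induction f using MvPolynomial.induction_on' with
  | monomial d c =>
    rw [homogeneousComponent_of_mem (hr.mul (isHomogeneous_monomial c rfl)), if_neg (by omega)]
  | add p q hp hq => simp only [mul_add, map_add, hp, hq, add_zero]

end HomogeneousComponent

/-! ### Face modules -/

section FaceModules

variable (k : Type w) [Field k] {V : Type u}

variable {k} in
-- A monomial ideal contains a polynomial exactly when it contains its monomials. As `D` is closed
-- under subsets, a squarefree non-face divides `x^m` if and only if the support of `m` is itself a
-- non-face.
theorem mem_nonfaceIdeal_iff {D : LowerSet (Finset V)} {f : MvPolynomial V k} :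
    f ∈ nonfaceIdeal k D ↔ ∀ m ∈ f.support, m.support ∉ D := by
  classical
  have key : ∀ σ : Finset V, (∏ v ∈ σ, X v : MvPolynomial V k) =
      monomial (∑ v ∈ σ, Finsupp.single v 1) 1 := fun σ => by
    rw [monomial_sum_one]; rfl
  have hset : {m : MvPolynomial V k | ∃ σ : Finset V, σ ∉ D ∧ m = ∏ v ∈ σ, X v} =
      (fun s => monomial s (1 : k)) ''
        {s | ∃ σ : Finset V, σ ∉ D ∧ s = ∑ v ∈ σ, Finsupp.single v 1} := by
    ext m
    constructor
    · rintro ⟨σ, hσ, rfl⟩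
      exact ⟨_, ⟨σ, hσ, rfl⟩, (key σ).symm⟩
    · rintro ⟨_, ⟨σ, hσ, rfl⟩, rfl⟩
      exact ⟨σ, hσ, (key σ).symm⟩
  rw [nonfaceIdeal, hset, mem_ideal_span_monomial_image]
  refine forall₂_congr fun m _ => ?_
  have hval : ∀ (σ : Finset V) v, (∑ u ∈ σ, Finsupp.single u 1 : V →₀ ℕ) v =
      if v ∈ σ then 1 else 0 := fun σ v => by
    simp [Finsupp.finsetSum_apply, Finsupp.single_apply]
  constructor
  · rintro ⟨_, ⟨σ, hσ, rfl⟩, hle⟩ hm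
    refine hσ (D.lower (fun v hv => ?_) hm)
    have := hle v
    rw [hval, if_pos hv] at this
    exact Finsupp.mem_support_iff.2 (by omega)
  · intro hm
    refine ⟨_, ⟨m.support, hm, rfl⟩, fun v => ?_⟩
    rw [hval]
    split_ifs with h
    · have := Finsupp.mem_support_iff.1 h
      omega
    · exact Nat.zero_le _

theorem prod_X_mem_nonfaceIdeal {D : LowerSet (Finset V)} {σ : Finset V} (hσ : σ ∉ D) :
    ∏ v ∈ σ, X v ∈ nonfaceIdeal k D :=
  Ideal.subset_span ⟨σ, hσ, rfl⟩

attribute [local instance] MvPolynomial.gradedAlgebra in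
theorem isHomogeneous_nonfaceIdeal (D : LowerSet (Finset V)) :
    (nonfaceIdeal k D).IsHomogeneous (homogeneousSubmodule V k) := by
  refine Ideal.homogeneous_span _ _ ?_
  rintro _ ⟨σ, -, rfl⟩
  exact ⟨_, IsHomogeneous.prod _ _ _ fun v _ => isHomogeneous_X k v⟩

theorem homogeneousComponent_mem_nonfaceIdeal (j : ℕ) {D : LowerSet (Finset V)}
    {f : MvPolynomial V k} (hf : f ∈ nonfaceIdeal k D) :
    homogeneousComponent j f ∈ nonfaceIdeal k D :=
  homogeneousComponent_mem_of_mem (isHomogeneous_nonfaceIdeal k D) hf j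

/-- The class in `k[Ψ]` of an element of `I_Γ`. -/
def FaceModule.mk (Ψ : RelativeComplex V) (f : MvPolynomial V k) (hf : f ∈ nonfaceIdeal k Ψ.Γ) :
    FaceModule k Ψ := toFaceModule k Ψ ⟨f, hf⟩

variable {k}

namespace FaceModule

theorem exists_mk {Ψ : RelativeComplex V} (x : FaceModule k Ψ) : ∃ f hf, x = mk k Ψ f hf := by
  obtain ⟨⟨f, hf⟩, rfl⟩ := Submodule.mkQ_surjective _ x
  exact ⟨f, hf, rfl⟩

theorem mk_eq_mk_iff {Ψ : RelativeComplex V} {f g : MvPolynomial V k} {hf hg} :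
    mk k Ψ f hf = mk k Ψ g hg ↔ f - g ∈ nonfaceIdeal k Ψ.Δ := by
  refine (Submodule.Quotient.eq _).trans ?_
  rfl

theorem mk_eq_zero_iff {Ψ : RelativeComplex V} {f : MvPolynomial V k} {hf} :
    mk k Ψ f hf = 0 ↔ f ∈ nonfaceIdeal k Ψ.Δ := by
  refine (Submodule.Quotient.mk_eq_zero _).trans ?_
  rfl

theorem mk_add {Ψ : RelativeComplex V} {f g : MvPolynomial V k} {hf hg} :
    mk k Ψ f hf + mk k Ψ g hg = mk k Ψ (f + g) (add_mem hf hg) := rfl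

theorem sum_mk {Ω : RelativeComplex V} {ι : Type*} (s : Finset ι) (f : ι → MvPolynomial V k)
    (hf : ∀ i, f i ∈ nonfaceIdeal k Ω.Γ) :
    ∑ i ∈ s, mk k Ω (f i) (hf i) =
      mk k Ω (∑ i ∈ s, f i) (sum_mem fun i _ => hf i) := by
  classical
  induction s using Finset.induction_on with
  | empty => exact (mk_eq_zero_iff.2 (zero_mem _)).symm
  | insert a s ha ih =>
    rw [Finset.sum_insert ha, ih, mk_add, mk_eq_mk_iff, Finset.sum_insert ha,
      sub_self]
    exact zero_mem _

theorem smul_mk {Ψ : RelativeComplex V} {f : MvPolynomial V k} {hf} (r : MvPolynomial V k) :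
    r • mk k Ψ f hf = mk k Ψ (r * f) (Ideal.mul_mem_left _ r hf) := rfl

theorem restrict_mk {Ψ Ψ' : RelativeComplex V} (hΔ : Ψ'.Δ ≤ Ψ.Δ) (hΓ : Ψ'.Γ ≤ Ψ.Γ)
    {f : MvPolynomial V k} {hf} :
    restrictFaceModule k hΔ hΓ (mk k Ψ f hf) = mk k Ψ' f (nonfaceIdeal_antitone k hΓ hf) := rfl

/-- The map `k[Ψ] → k[Ψ']` induced by a linear endomorphism of the polynomial ring. -/
def map {Ψ Ψ' : RelativeComplex V} (g : MvPolynomial V k →ₗ[k] MvPolynomial V k)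
    (hΓ : ∀ f ∈ nonfaceIdeal k Ψ.Γ, g f ∈ nonfaceIdeal k Ψ'.Γ)
    (hΔ : ∀ f ∈ nonfaceIdeal k Ψ.Δ, g f ∈ nonfaceIdeal k Ψ'.Δ) :
    FaceModule k Ψ →ₗ[k] FaceModule k Ψ' :=
  ((((nonfaceIdeal k Ψ.Δ).submoduleOf (nonfaceIdeal k Ψ.Γ)).restrictScalars k).liftQ
    (((toFaceModule k Ψ').restrictScalars k).comp
      (g.restrict (p := (nonfaceIdeal k Ψ.Γ).restrictScalars k)
        (q := (nonfaceIdeal k Ψ'.Γ).restrictScalars k) hΓ))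
    fun x hx => (mk_eq_zero_iff (hf := hΓ _ x.2)).2 (hΔ _ hx)).comp
    (Submodule.Quotient.restrictScalarsEquiv k
      ((nonfaceIdeal k Ψ.Δ).submoduleOf (nonfaceIdeal k Ψ.Γ))).symm.toLinearMap

/-- The projection of `k[Ψ]` to its piece of degree `j`. -/
def proj (Ψ : RelativeComplex V) (j : ℕ) : FaceModule k Ψ →ₗ[k] FaceModule k Ψ :=
  map (homogeneousComponent j) (fun _ => homogeneousComponent_mem_nonfaceIdeal k j)
    fun _ => homogeneousComponent_mem_nonfaceIdeal k j

theorem proj_mk {Ψ : RelativeComplex V} (j : ℕ) {f : MvPolynomial V k} {hf} :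
    proj Ψ j (mk k Ψ f hf) =
      mk k Ψ (homogeneousComponent j f) (homogeneousComponent_mem_nonfaceIdeal k j hf) := rfl

theorem proj_mem {Ψ : RelativeComplex V} (j : ℕ) (x : FaceModule k Ψ) :
    proj Ψ j x ∈ faceModulePiece k Ψ j := by
  obtain ⟨f, hf, rfl⟩ := exists_mk x
  exact ⟨⟨_, homogeneousComponent_mem_nonfaceIdeal k j hf⟩, homogeneousComponent_mem j f, rfl⟩

theorem mem_faceModulePiece_iff {Ψ : RelativeComplex V} {j : ℕ} {x : FaceModule k Ψ} :
    x ∈ faceModulePiece k Ψ j ↔ ∃ f hf, f.IsHomogeneous j ∧ x = mk k Ψ f hf := by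
  constructor
  · rintro ⟨⟨f, hf⟩, h, rfl⟩
    exact ⟨f, hf, h, rfl⟩
  · rintro ⟨f, hf, h, rfl⟩
    exact ⟨⟨f, hf⟩, h, rfl⟩

theorem proj_of_mem {Ψ : RelativeComplex V} {j : ℕ} {x : FaceModule k Ψ}
    (hx : x ∈ faceModulePiece k Ψ j) : proj Ψ j x = x := by
  obtain ⟨f, hf, h, rfl⟩ := mem_faceModulePiece_iff.1 hx
  rw [proj_mk, mk_eq_mk_iff, homogeneousComponent_of_mem h, if_pos rfl, sub_self]
  exact zero_mem _

theorem proj_add_smul {Ψ : RelativeComplex V} {r : MvPolynomial V k} {a : ℕ}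
    (hr : r.IsHomogeneous a) (b : ℕ) (x : FaceModule k Ψ) :
    proj Ψ (a + b) (r • x) = r • proj Ψ b x := by
  obtain ⟨f, hf, rfl⟩ := exists_mk x
  rw [smul_mk, proj_mk, proj_mk, smul_mk, mk_eq_mk_iff, homogeneousComponent_add_mul hr, sub_self]
  exact zero_mem _

theorem proj_smul_of_lt {Ψ : RelativeComplex V} {r : MvPolynomial V k} {a : ℕ}
    (hr : r.IsHomogeneous a) {j : ℕ} (hj : j < a) (x : FaceModule k Ψ) :
    proj Ψ j (r • x) = 0 := by
  obtain ⟨f, hf, rfl⟩ := exists_mk x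
  rw [smul_mk, proj_mk, mk_eq_zero_iff, homogeneousComponent_mul_of_lt hr hj]
  exact zero_mem _

theorem eq_sum_proj {Ψ : RelativeComplex V} (x : FaceModule k Ψ) :
    ∃ N, x = ∑ j ∈ Finset.range N, proj Ψ j x := by
  obtain ⟨f, hf, rfl⟩ := exists_mk x
  refine ⟨f.totalDegree + 1, ?_⟩
  simp only [proj_mk]
  rw [sum_mk, mk_eq_mk_iff, sum_homogeneousComponent, sub_self]
  exact zero_mem _

/-- The submodule `⟨rs⟩M` is graded, so it suffices to treat the components of `x`. Since `r` has no
constant term, the degree `j` component of `r • x` only involves components of `x` of smaller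
degree, and strong induction on `j` applies. -/
theorem gradedSeparated (Ψ : RelativeComplex V) : GradedSeparated k V (FaceModule k Ψ) := by
  intro rs hrs r hr x hx
  set N := (Ideal.ofList rs • ⊤ : Submodule (MvPolynomial V k) (FaceModule k Ψ)) with hN
  have hproj : ∀ j, ∀ y ∈ N, proj Ψ j y ∈ N := by
    intro j y hy
    refine Submodule.smul_induction_on hy ?_ fun a b ha hb => by
      rw [map_add]; exact add_mem ha hb
    intro c hc z _
    obtain ⟨M, hM⟩ := eq_sum_proj z
    rw [← sum_homogeneousComponent c, hM, Finset.sum_smul, map_sum]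
    refine sum_mem fun a _ => ?_
    have hmem : homogeneousComponent a c ∈ Ideal.ofList rs :=
      homogeneousComponent_mem_of_mem (isHomogeneous_ofList hrs) hc a
    rcases lt_or_ge j a with h | h
    · rw [proj_smul_of_lt (homogeneousComponent_isHomogeneous a c) h]
      exact zero_mem _
    · obtain ⟨b, rfl⟩ := Nat.exists_eq_add_of_le h
      rw [proj_add_smul (homogeneousComponent_isHomogeneous a c)]
      exact Submodule.smul_mem_smul hmem trivial
  have key : ∀ j, proj Ψ j x ∈ N := by
    intro j
    induction j using Nat.strong_induction_on with
    | _ j ih =>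
      have h1 : proj Ψ j (r • x) ∈ N := by
        rw [← sum_homogeneousComponent r, Finset.sum_smul, map_sum]
        refine sum_mem fun a _ => ?_
        rcases Nat.eq_zero_or_pos a with rfl | ha
        · rw [homogeneousComponent_zero, ← constantCoeff_eq, hr, C_0, zero_smul, map_zero]
          exact zero_mem _
        rcases lt_or_ge j a with h | h
        · rw [proj_smul_of_lt (homogeneousComponent_isHomogeneous a r) h]
          exact zero_mem _
        · obtain ⟨b, rfl⟩ := Nat.exists_eq_add_of_le h
          rw [proj_add_smul (homogeneousComponent_isHomogeneous a r)]
          exact N.smul_mem _ (ih b (by omega))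
      have h2 := add_mem (hproj j _ hx) h1
      rwa [map_sub, sub_add_cancel] at h2
  obtain ⟨M, hM⟩ := eq_sum_proj x
  rw [hM]
  exact sum_mem fun j _ => key j

theorem nonfaceIdeal_le_annihilator (Ψ : RelativeComplex V) :
    nonfaceIdeal k Ψ.Δ ≤ Module.annihilator (MvPolynomial V k) (FaceModule k Ψ) := by
  intro f hf
  rw [Module.mem_annihilator]
  intro x
  obtain ⟨g, hg, rfl⟩ := exists_mk x
  rw [smul_mk, mk_eq_zero_iff]
  exact Ideal.mul_mem_right _ _ hf

instance [Finite V] (Ψ : RelativeComplex V) : Module.Finite (MvPolynomial V k) (FaceModule k Ψ) :=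
  inferInstanceAs (Module.Finite (MvPolynomial V k)
    (nonfaceIdeal k Ψ.Γ ⧸ (nonfaceIdeal k Ψ.Δ).submoduleOf (nonfaceIdeal k Ψ.Γ)))

/-- If every face of `Δ` lies in a face of `Ψ = (Δ, Γ)`, then `k[Ψ]` is a faithful module over
`k[Δ]`. -/
theorem annihilator_eq {Ψ : RelativeComplex V}
    (h : ∀ ρ ∈ Ψ.Δ, ∃ σ, Ψ.IsFace σ ∧ ρ ⊆ σ) :
    Module.annihilator (MvPolynomial V k) (FaceModule k Ψ) = nonfaceIdeal k Ψ.Δ := by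
  classical
  refine le_antisymm (fun f hf => ?_) (nonfaceIdeal_le_annihilator Ψ)
  rw [mem_nonfaceIdeal_iff]
  intro m hm hmΔ
  obtain ⟨σ, hσ, hmσ⟩ := h _ hmΔ
  have h0 := Module.mem_annihilator.1 hf (mk k Ψ _ (prod_X_mem_nonfaceIdeal k hσ.2))
  rw [smul_mk, mk_eq_zero_iff, mem_nonfaceIdeal_iff] at h0
  have hmon : (∏ v ∈ σ, X v : MvPolynomial V k) = monomial (∑ v ∈ σ, Finsupp.single v 1) 1 := by
    rw [monomial_sum_one]; rfl
  have hval : ∀ v, (∑ u ∈ σ, Finsupp.single u 1 : V →₀ ℕ) v = if v ∈ σ then 1 else 0 := fun v => by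
    simp [Finsupp.finsetSum_apply, Finsupp.single_apply]
  -- Multiplication by `x_σ` moves the coefficient of `x^m` without cancellation, and the new
  -- support stays inside the face `σ` because `m` is supported in `σ`.
  refine h0 (m + ∑ v ∈ σ, Finsupp.single v 1) ?_ (Ψ.Δ.lower ?_ hσ.1)
  · rw [mem_support_iff, hmon, coeff_mul_monomial, mul_one]
    exact mem_support_iff.1 hm
  · intro v hv
    by_contra hvσ
    have h1 : m v = 0 := by
      by_contra h2
      exact hvσ (hmσ (Finsupp.mem_support_iff.2 h2))
    exact Finsupp.mem_support_iff.1 hv (by rw [Finsupp.add_apply, hval, if_neg hvσ, h1, add_zero])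

end FaceModule

end FaceModules

/-! ### Systems of parameters of face modules -/

section Parameters

open RingTheory.Sequence

variable {k : Type w} [Field k] {V : Type u}

/-- Killing the variables one after the other gives a strictly increasing chain of primes, the
kernels of the substitutions `ev T`, that ends inside the irrelevant ideal. -/
theorem card_le_height_ker_constantCoeff [Fintype V] :
    (Fintype.card V : ℕ∞) ≤
      (RingHom.ker (constantCoeff : MvPolynomial V k →+* k)).height := by
  classical
  let ev : Finset V → MvPolynomial V k →ₐ[k] MvPolynomial V k :=
    fun T => aeval fun v => if v ∈ T then 0 else X v
  have hev : ∀ T v, ev T (X v) = if v ∈ T then 0 else X v := fun T v => by simp [ev]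
  have hprime : ∀ T, (RingHom.ker (ev T)).IsPrime := fun T => RingHom.ker_isPrime _
  have key : ∀ T : Finset V, (T.card : ℕ∞) ≤ (RingHom.ker (ev T)).height := by
    intro T
    induction T using Finset.induction_on with
    | empty => simp
    | insert v T hv ih =>
      have hlt : RingHom.ker (ev T) < RingHom.ker (ev (insert v T)) := by
        have hcomp : ev (insert v T) = (ev {v}).comp (ev T) := by
          refine algHom_ext fun u => ?_
          rw [AlgHom.comp_apply, hev, hev]
          by_cases h1 : u ∈ T
          · simp [h1]
          · simp [h1, hev]
        refine lt_of_le_of_ne (fun f hf => ?_) fun e => ?_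
        · rw [RingHom.mem_ker] at hf ⊢
          rw [hcomp, AlgHom.comp_apply, hf, map_zero]
        · have h1 : (X v : MvPolynomial V k) ∈ RingHom.ker (ev T) := by
            rw [e, RingHom.mem_ker, hev, if_pos (Finset.mem_insert_self v T)]
          rw [RingHom.mem_ker, hev, if_neg hv] at h1
          exact X_ne_zero v h1
      rw [Finset.card_insert_of_notMem hv]
      have := Ideal.height_add_one_le_of_lt_of_isPrime hlt
      push_cast
      exact (add_le_add_left ih 1).trans this
  refine (key Finset.univ).trans (Ideal.height_mono fun f hf => ?_)
  have hc : (constantCoeff : MvPolynomial V k →+* k).comp (ev Finset.univ).toRingHom =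
      constantCoeff := by
    refine ringHom_ext (fun r => ?_) fun v => ?_
    · simp
    · simp [hev]
  have := RingHom.congr_fun hc f
  rw [RingHom.mem_ker] at hf ⊢
  rw [← this]
  simp [hf]

/-- A homogeneous system of parameters modulo an ideal that vanishes on a coordinate subspace has at
least as many entries as the dimension of that subspace. -/
theorem card_le_length_of_X_mem_radical [Fintype V] {I : Ideal (MvPolynomial V k)} {F : Finset V}
    (hI : I ≤ Ideal.span (X '' {v | v ∉ F})) {φ : List (MvPolynomial V k)}
    (hφ : ∀ f ∈ φ, IsPosHomogeneous f) (hrad : ∀ v, X v ∈ (I ⊔ Ideal.ofList φ).radical) :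
    F.card ≤ φ.length := by
  classical
  set s : Set (MvPolynomial V k) := X '' {v | v ∉ F} ∪ {f | f ∈ φ} with hs
  -- The irrelevant ideal is minimal over the variables outside `F` together with `φ`. Krull's
  -- height theorem bounds its height, which is at least `|V|`, by `(|V| - |F|) + φ.length`.
  have hmin : RingHom.ker (constantCoeff : MvPolynomial V k →+* k) ∈
      (Ideal.span s).minimalPrimes := by
    refine ⟨⟨RingHom.ker_isPrime _, Ideal.span_le.2 ?_⟩, ?_⟩
    · rintro f (⟨v, -, rfl⟩ | hf)
      · simp
      · exact (hφ f hf).constantCoeff_eq_zero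
    · rintro P ⟨hP, hle⟩ -
      refine ker_constantCoeff_le fun v => hP.radical_le_iff.2 (le_trans ?_ hle) (hrad v)
      rw [hs, Ideal.span_union]
      exact sup_le_sup_right hI _
  have hsfin : s.Finite := ((Set.toFinite _).image _).union φ.finite_toSet
  have h1 := card_le_height_ker_constantCoeff.trans
    (Ideal.height_le_card_of_mem_minimalPrimes_span hsfin hmin)
  have h2 : Fintype.card V ≤ s.ncard := by exact_mod_cast h1
  have h3 : s.ncard ≤ (Fintype.card V - F.card) + φ.length := by
    refine (Set.ncard_union_le _ _).trans (add_le_add ?_ ?_)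
    · refine (Set.ncard_image_le (Set.toFinite _)).trans_eq ?_
      have : {v | v ∉ F} = ((Fᶜ : Finset V) : Set V) := by ext; simp
      rw [this, Set.ncard_coe_finset, Finset.card_compl]
    · have : {f | f ∈ φ} = (φ.toFinset : Set (MvPolynomial V k)) := by ext; simp
      rw [this, Set.ncard_coe_finset]
      exact List.toFinset_card_le φ
  have h4 : F.card ≤ Fintype.card V := Finset.card_le_univ F
  omega

/-- A sequence with a finite dimensional quotient generates the irrelevant ideal up to radical,
modulo the annihilator. -/
theorem GradedSeparated.X_mem_radical {M : Type*} [AddCommGroup M] [Module (MvPolynomial V k) M]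
    [Module k M] [IsScalarTower k (MvPolynomial V k) M] [Module.Finite (MvPolynomial V k) M]
    [Finite V] (hM : GradedSeparated k V M) {φ : List (MvPolynomial V k)}
    (hφ : HasFiniteQuotient k M φ) (v : V) :
    X v ∈ (Module.annihilator (MvPolynomial V k) M ⊔ Ideal.ofList φ).radical := by
  obtain ⟨hφ1, hfin⟩ := hφ
  set N := (Ideal.ofList φ • ⊤ : Submodule (MvPolynomial V k) M) with hN
  have hart : IsArtinian (MvPolynomial V k) (M ⧸ N) := isArtinian_of_tower k inferInstance
  -- On the finite dimensional quotient the images of the powers of `x_v` stabilize. The stable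
  -- image `L` satisfies `L ⊆ x_v L`, so Nakayama and separatedness give `x_v^n M ⊆ ⟨φ⟩M`.
  obtain ⟨n, hn⟩ := IsArtinian.range_smul_pow_stabilizes (M ⧸ N) (X v : MvPolynomial V k)
  set L := LinearMap.range ((X v ^ n : MvPolynomial V k) •
    (LinearMap.id : (M ⧸ N) →ₗ[MvPolynomial V k] (M ⧸ N))) with hL
  obtain ⟨r, hr, hrL⟩ := Submodule.exists_sub_one_mem_and_smul_eq_zero_of_fg_of_le_smul
    (Ideal.span {(X v : MvPolynomial V k)}) L (IsNoetherian.noetherian L) (by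
      intro y hy
      rw [hn (n + 1) (Nat.le_succ n)] at hy
      obtain ⟨x, rfl⟩ := hy
      have : ((X v ^ (n + 1) : MvPolynomial V k) •
          (LinearMap.id : (M ⧸ N) →ₗ[MvPolynomial V k] (M ⧸ N))) x =
          (X v : MvPolynomial V k) • ((X v ^ n : MvPolynomial V k) •
            (LinearMap.id : (M ⧸ N) →ₗ[MvPolynomial V k] (M ⧸ N))) x := by
        simp [smul_smul, pow_succ']
      rw [this]
      exact Submodule.smul_mem_smul (Ideal.mem_span_singleton_self _) ⟨x, rfl⟩)
  have hle : LinearMap.range ((X v ^ n : MvPolynomial V k) •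
      (LinearMap.id : M →ₗ[MvPolynomial V k] M)) ≤ Ideal.ofList φ • ⊤ := by
    rintro _ ⟨x, rfl⟩
    refine hM φ hφ1 (1 - r) ?_ _ ?_
    · obtain ⟨c, hc⟩ := Ideal.mem_span_singleton'.1 hr
      rw [← neg_sub, ← hc]
      simp
    · have h0 := hrL _ ⟨Submodule.Quotient.mk x, rfl⟩
      have : ((X v ^ n : MvPolynomial V k) • (LinearMap.id : M →ₗ[MvPolynomial V k] M)) x -
          (1 - r) • ((X v ^ n : MvPolynomial V k) • (LinearMap.id : M →ₗ[MvPolynomial V k] M)) x =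
          r • (X v ^ n : MvPolynomial V k) • x := by
        simp [sub_smul]
      rw [this, ← hN, ← Submodule.Quotient.mk_eq_zero]
      exact h0
  -- The Cayley–Hamilton theorem yields a monic `p` such that `p(x_v^n)` annihilates `M` and all
  -- lower coefficients lie in `⟨φ⟩`. Only the leading power of `x_v` survives modulo the
  -- annihilator and `φ`.
  obtain ⟨p, hp, -, hcoeff, hzero⟩ :=
    LinearMap.exists_monic_and_natDegree_eq_and_coeff_mem_pow_and_aeval_eq_zero _ _ _ hle
  refine ⟨n * p.natDegree, ?_⟩
  have hann : p.eval (X v ^ n : MvPolynomial V k) ∈ Module.annihilator (MvPolynomial V k) M := by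
    have h1 : ((X v ^ n : MvPolynomial V k) • (LinearMap.id : M →ₗ[MvPolynomial V k] M)) =
        algebraMap (MvPolynomial V k) (Module.End (MvPolynomial V k) M) (X v ^ n) := rfl
    rw [h1, Polynomial.aeval_algebraMap_apply, Polynomial.coe_aeval_eq_eval] at hzero
    rw [Module.mem_annihilator]
    intro m
    exact LinearMap.congr_fun hzero m
  rw [Polynomial.eval_eq_sum_range, Finset.sum_range_succ, hp.coeff_natDegree, one_mul,
    ← pow_mul] at hann
  have h2 : ∑ i ∈ Finset.range p.natDegree, p.coeff i * (X v ^ n) ^ i ∈ Ideal.ofList φ :=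
    sum_mem fun i hi => Ideal.mul_mem_right _ _
      (Ideal.pow_le_self (by have := Finset.mem_range.1 hi; omega) (hcoeff i))
  have h3 := sub_mem (Submodule.mem_sup_left (T := Ideal.ofList φ) hann)
    (Submodule.mem_sup_right (S := Module.annihilator (MvPolynomial V k) M) h2)
  rwa [add_sub_cancel_left] at h3

end Parameters

/-! ### Generic linear forms are regular on the stars of nonempty faces. -/

section Generic

open RingTheory.Sequence

variable {k : Type w} [Field k] {V : Type u}

theorem exists_isFace_of_ne_zero {Ψ : RelativeComplex V} {x : FaceModule k Ψ} (hx : x ≠ 0) :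
    ∃ σ, Ψ.IsFace σ := by
  obtain ⟨f, hf, rfl⟩ := FaceModule.exists_mk x
  rw [Ne, FaceModule.mk_eq_zero_iff, mem_nonfaceIdeal_iff] at hx
  push Not at hx
  obtain ⟨m, hm, hmΔ⟩ := hx
  exact ⟨_, hmΔ, mem_nonfaceIdeal_iff.1 hf m hm⟩

/-- Every face of the ambient complex of a Buchsbaum complex lies in a facet of full dimension. -/
theorem RelativeComplex.IsPureOfDim.exists_facet [Finite V] [DecidableEq V]
    {Ψ : RelativeComplex V} {d : ℤ}
    {n : ℕ} (hn : (n : ℤ) = d + 1) (hpure : Ψ.IsPureOfDim d)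
    (hCM : ∀ τ ∈ Ψ.Δ, τ.Nonempty → IsCohenMacaulay k (V := V) (FaceModule k (Ψ.star τ)))
    {ρ : Finset V} (hρ : ρ ∈ Ψ.Δ) (hne : ρ.Nonempty) : ∃ F, Ψ.IsFace F ∧ ρ ⊆ F ∧ F.card = n := by
  -- A Cohen–Macaulay module is nonzero, so the star of `ρ` has a relative face `σ`; then `ρ ∪ σ` is
  -- a face of `Ψ` and extends to a facet.
  obtain ⟨φ, -, hreg⟩ := hCM ρ hρ hne
  have := hreg.nontrivial
  obtain ⟨x, hx⟩ := exists_ne (0 : FaceModule k (Ψ.star ρ))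
  obtain ⟨σ, hσ1, hσ2⟩ := exists_isFace_of_ne_zero hx
  have hface : Ψ.IsFace (ρ ∪ σ) :=
    ⟨hσ1.2, fun h => hσ2 ⟨Ψ.Γ.lower Finset.subset_union_right h, h⟩⟩
  obtain ⟨F, hle, hF⟩ := (Set.toFinite {σ | Ψ.IsFace σ}).exists_le_maximal hface
  refine ⟨F, hF.prop, Finset.subset_union_left.trans hle, ?_⟩
  have := hpure.2 F hF
  omega

open scoped Classical in
/-- The linear forms with coefficients `c`. -/
def linearForm [Fintype V] (Ψ : RelativeComplex V) {n : ℕ} (c : Fin n × Ψ.Vertex → k) (t : Fin n) :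
    MvPolynomial V k :=
  ∑ v : Ψ.Vertex, C (c (t, v)) * X v.1

theorem isHomogeneous_linearForm [Fintype V] (Ψ : RelativeComplex V) {n : ℕ}
    (c : Fin n × Ψ.Vertex → k) (t : Fin n) : (linearForm Ψ c t).IsHomogeneous 1 :=
  IsHomogeneous.sum _ _ _ fun _ _ => isHomogeneous_C_mul_X _ _

/-- The vertices of a face. -/
def vertexOf {Ψ : RelativeComplex V} {σ : Finset V} (hσ : σ ∈ Ψ.Δ) (v : σ) : Ψ.Vertex :=
  ⟨v.1, Ψ.Δ.lower (Finset.singleton_subset_iff.2 v.2) hσ⟩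

/-- The linear forms restrict to a basis of the linear forms of every face with `n` vertices. -/
def RestrictsToBases (Ψ : RelativeComplex V) {n : ℕ} (c : Fin n × Ψ.Vertex → k) : Prop :=
  ∀ σ (hσ : σ ∈ Ψ.Δ), σ.card = n → ∃ e : Fin n ≃ σ,
    (Matrix.of fun t i => c (t, vertexOf hσ (e i))).det ≠ 0

/-- The required polynomial is the product, over the faces with `n` vertices, of the determinants of
the matrices of coefficient variables. Each factor is a generic determinant in distinct variables,
and the polynomial ring is a domain. -/
theorem holdsGenerically_restrictsToBases [Finite V] (Ψ : RelativeComplex V) (n : ℕ) :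
    HoldsGenerically fun c : Fin n × Ψ.Vertex → k => RestrictsToBases Ψ c := by
  classical
  have := Fintype.ofFinite {σ : Finset V // σ ∈ Ψ.Δ ∧ σ.card = n}
  let e : ∀ σ : {σ : Finset V // σ ∈ Ψ.Δ ∧ σ.card = n}, Fin n ≃ σ.1 :=
    fun σ => (Fintype.equivFinOfCardEq (by simpa using σ.2.2)).symm
  let i : ∀ σ : {σ : Finset V // σ ∈ Ψ.Δ ∧ σ.card = n}, Fin n × Fin n → Fin n × Ψ.Vertex :=
    fun σ p => (p.1, vertexOf σ.2.1 (e σ p.2))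
  have hi : ∀ σ, Function.Injective (i σ) := by
    rintro σ ⟨a, b⟩ ⟨a', b'⟩ h
    have h1 := congrArg Prod.fst h
    have h2 := congrArg (fun p => p.2.1) h
    exact Prod.ext h1 ((e σ).injective (Subtype.ext h2))
  refine ⟨∏ σ, rename (i σ) (Matrix.mvPolynomialX (Fin n) (Fin n) k).det, ?_, ?_⟩
  · rw [Finset.prod_ne_zero_iff]
    intro σ _ h0
    exact Matrix.det_mvPolynomialX_ne_zero (Fin n) k
      (rename_injective _ (hi σ) (h0.trans (map_zero _).symm))
  · intro c hc σ hσ hcard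
    rw [map_prod, Finset.prod_ne_zero_iff] at hc
    refine ⟨e ⟨σ, hσ, hcard⟩, ?_⟩
    have := hc ⟨σ, hσ, hcard⟩ (Finset.mem_univ _)
    rw [eval_rename, RingHom.map_det] at this
    convert this using 2
    ext a b
    simp [i]

/-- Stanley's criterion for linear systems of parameters of a face ring. -/
theorem RestrictsToBases.X_mem_radical [Fintype V] {Ψ : RelativeComplex V} {n : ℕ}
    {c : Fin n × Ψ.Vertex → k} (hc : RestrictsToBases Ψ c) {D : LowerSet (Finset V)}
    (hD : ∀ ρ ∈ D, ∃ F ∈ Ψ.Δ, ρ ⊆ F ∧ F.card = n) (v : V) :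
    X v ∈ (nonfaceIdeal k D ⊔ Ideal.ofList (List.ofFn (linearForm Ψ c))).radical := by
  classical
  rw [Ideal.radical_eq_sInf, Ideal.mem_sInf]
  rintro P ⟨hle, hP⟩
  -- The variables outside a prime containing `I_D` form a face of `D`, since some variable of each
  -- non-face lies in the prime.
  set U : Finset V := {u | (X u : MvPolynomial V k) ∉ P} with hU
  have hUD : U ∈ D := by
    by_contra hUD
    have h1 := hle (Ideal.mem_sup_left (prod_X_mem_nonfaceIdeal k hUD))
    obtain ⟨u, hu, huP⟩ := hP.prod_mem_iff.1 h1
    exact (Finset.mem_filter.1 hu).2 huP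
  obtain ⟨F, hF, hUF, hcard⟩ := hD U hUD
  obtain ⟨e, he⟩ := hc F hF hcard
  have hout : ∀ u ∉ F, Ideal.Quotient.mk P (X u) = 0 := fun u hu => by
    by_contra h1
    exact hu (hUF (Finset.mem_filter.2 ⟨Finset.mem_univ u,
      fun h2 => h1 (Ideal.Quotient.eq_zero_iff_mem.2 h2)⟩))
  let q : k →+* MvPolynomial V k ⧸ P := (Ideal.Quotient.mk P).comp C
  set A := (Matrix.of fun t i => c (t, vertexOf hF (e i))) with hA
  -- Modulo `P` only the variables of `F` can survive, so the vanishing of the forms becomes a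
  -- square linear system. Its determinant is a nonzero scalar, so all variables vanish.
  have hmul : (q.mapMatrix A).mulVec (fun i => Ideal.Quotient.mk P (X (e i).1)) = 0 := by
    ext t
    have h1 : linearForm Ψ c t ∈ P := hle (Ideal.mem_sup_right
      (Ideal.subset_span (List.mem_ofFn.2 ⟨t, rfl⟩)))
    have h2 := Ideal.Quotient.eq_zero_iff_mem.2 h1
    rw [linearForm, map_sum] at h2
    rw [Pi.zero_apply, ← h2]
    refine Fintype.sum_of_injective (fun i => vertexOf hF (e i)) ?_ _ _ ?_ ?_
    · intro a b hab
      exact e.injective (Subtype.ext (congrArg (fun u : Ψ.Vertex => u.1) hab))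
    · intro u hu
      rw [map_mul, hout u.1 fun huF => hu ⟨e.symm ⟨u.1, huF⟩, by simp [vertexOf]⟩, mul_zero]
    · intro i
      simp [q, hA, vertexOf]
  have hdet : (q.mapMatrix A).det ≠ 0 := by
    rw [← RingHom.map_det]
    exact (map_ne_zero q).2 he
  have hzero := Matrix.eq_zero_of_mulVec_eq_zero hdet hmul
  rw [← Ideal.Quotient.eq_zero_iff_mem]
  by_cases hv : v ∈ F
  · have := congrFun hzero (e.symm ⟨v, hv⟩)
    simpa using this
  · exact hout v hv

/-- Purity puts every face of the star in a facet with `n` vertices that contains `τ`. This makes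
`I_{st_τ Δ}` the exact annihilator, lets Stanley's criterion apply, and shows that the regular
sequence `φ` from the hypothesis has at least `n` entries; the exchange argument then applies. -/
theorem isWeaklyRegular_linearForm [Infinite k] [Fintype V] [DecidableEq V] {Ψ : RelativeComplex V}
    {d : ℤ} {n : ℕ} (hn : (n : ℤ) = d + 1) (hpure : Ψ.IsPureOfDim d)
    (hCM : ∀ τ ∈ Ψ.Δ, τ.Nonempty → IsCohenMacaulay k (V := V) (FaceModule k (Ψ.star τ)))
    {c : Fin n × Ψ.Vertex → k} (hc : RestrictsToBases Ψ c) {τ : Finset V} (hτ : τ ∈ Ψ.Δ)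
    (hne : τ.Nonempty) :
    IsWeaklyRegular (FaceModule k (Ψ.star τ)) (List.ofFn (linearForm Ψ c)) := by
  have hfacet : ∀ ρ ∈ (Ψ.star τ).Δ, ∃ F, Ψ.IsFace F ∧ τ ∪ ρ ⊆ F ∧ F.card = n := fun ρ hρ =>
    hpure.exists_facet hn hCM hρ.2 (hne.mono Finset.subset_union_left)
  have hstar : ∀ F, Ψ.IsFace F → τ ⊆ F → (Ψ.star τ).IsFace F := fun F hF hτF =>
    ⟨⟨hF.1, by rw [Finset.union_eq_right.2 hτF]; exact hF.1⟩, fun h => hF.2 h.1⟩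
  have hann : Module.annihilator (MvPolynomial V k) (FaceModule k (Ψ.star τ)) =
      nonfaceIdeal k (Ψ.star τ).Δ := FaceModule.annihilator_eq fun ρ hρ => by
    obtain ⟨F, hF, hsub, -⟩ := hfacet ρ hρ
    exact ⟨F, hstar F hF (Finset.union_subset_left hsub), Finset.union_subset_right hsub⟩
  obtain ⟨φ, ⟨hφ, -⟩, hreg⟩ := hCM τ hτ hne
  have hsep := FaceModule.gradedSeparated (k := k) (Ψ.star τ)
  have hrad := hsep.X_mem_radical hφ
  rw [hann] at hrad
  refine hsep.isWeaklyRegular_of_X_mem_radical n (isHomogeneous_nonfaceIdeal k (Ψ.star τ).Δ)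
    hann.ge hφ.1 ?_ hreg.toIsWeaklyRegular hrad (hc.X_mem_radical ?_) (List.length_ofFn) ?_
  · intro f hf
    obtain ⟨t, rfl⟩ := List.mem_ofFn.1 hf
    exact ⟨1, one_pos, isHomogeneous_linearForm Ψ c t⟩
  · intro ρ hρ
    obtain ⟨F, hF, hsub, hcard⟩ := hfacet ρ hρ
    exact ⟨F, hF.1, Finset.union_subset_right hsub, hcard⟩
  · obtain ⟨F, hF, hτF, hcard⟩ := hpure.exists_facet hn hCM hτ hne
    rw [← hcard]
    refine card_le_length_of_X_mem_radical (Ideal.span_le.2 ?_) hφ.1 hrad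
    rintro _ ⟨σ, hσ, rfl⟩
    obtain ⟨u, hu, huF⟩ : ∃ u ∈ σ, u ∉ F := by
      by_contra! hcon
      exact hσ ((Ψ.star τ).Δ.lower hcon (hstar F hF hτF).1)
    exact Ideal.mem_of_dvd _ (Finset.dvd_prod_of_mem _ hu) (Ideal.subset_span ⟨u, huF, rfl⟩)

end Generic

/-! ### Linear endomorphisms of the polynomial ring that enlarge supports -/

section RaisesSupport

variable {k : Type w} [Field k] {V : Type u}

/-- An endomorphism `g` of the polynomial ring such that all monomials of `g (x^m)` are divisible by
the variable `x_v` and by the squarefree part of `x^m`. -/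
def RaisesSupport [DecidableEq V] (v : V) (g : MvPolynomial V k →ₗ[k] MvPolynomial V k) : Prop :=
  ∀ D E : LowerSet (Finset V), (∀ σ, insert v σ ∈ E → σ ∈ D) →
    ∀ f ∈ nonfaceIdeal k D, g f ∈ nonfaceIdeal k E

theorem raisesSupport_mul_X [DecidableEq V] (v : V) :
    RaisesSupport v (LinearMap.mulLeft k (X v : MvPolynomial V k)) := by
  intro D E h f hf
  rw [mem_nonfaceIdeal_iff] at hf ⊢
  intro m hm hmE
  rw [LinearMap.mulLeft_apply, support_X_mul, Finset.mem_map] at hm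
  obtain ⟨m', hm', rfl⟩ := hm
  refine hf m' hm' (h _ (E.lower (fun u hu => ?_) hmE))
  rw [addLeftEmbedding_apply, Finsupp.mem_support_iff, Finsupp.add_apply]
  rcases Finset.mem_insert.1 hu with rfl | hu
  · simp
  · have := Finsupp.mem_support_iff.1 hu
    omega

open scoped Classical in
/-- The projection of the polynomial ring to the span of the monomials with a given property. -/
def monomialProj (p : (V →₀ ℕ) → Prop) : MvPolynomial V k →ₗ[k] MvPolynomial V k :=
  (basisMonomials V k).constr k fun m => if p m then monomial m 1 else 0

open scoped Classical in
theorem coeff_monomialProj (p : (V →₀ ℕ) → Prop) (f : MvPolynomial V k) (m : V →₀ ℕ) :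
    coeff m (monomialProj p f) = if p m then coeff m f else 0 := by
  induction f using MvPolynomial.induction_on' with
  | monomial d c =>
    have h : monomial d c = c • basisMonomials V k d := by
      rw [coe_basisMonomials, smul_monomial, smul_eq_mul, mul_one]
    have h2 : monomialProj p (monomial d c : MvPolynomial V k) =
        c • if p d then monomial d 1 else 0 := by
      rw [h, map_smul, monomialProj, Module.Basis.constr_basis]
    rw [h2, coeff_smul, coeff_monomial]
    by_cases hdm : d = m
    · subst hdm
      rw [if_pos rfl]
      split_ifs <;> simp
    · split_ifs <;> simp [coeff_monomial, hdm]
  | add a b ha hb => rw [map_add, coeff_add, ha, hb, coeff_add]; split_ifs <;> simp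

theorem raisesSupport_monomialProj [DecidableEq V] {v : V} {p : (V →₀ ℕ) → Prop}
    (hp : ∀ m, p m → v ∈ m.support) : RaisesSupport (k := k) v (monomialProj p) := by
  classical
  intro D E h f hf
  rw [mem_nonfaceIdeal_iff] at hf ⊢
  intro m hm hmE
  rw [mem_support_iff, coeff_monomialProj] at hm
  split_ifs at hm with hpm
  · exact hf m (mem_support_iff.2 hm) (h _ (by rwa [Finset.insert_eq_of_mem (hp m hpm)]))
  · exact hm rfl

/-- Each nonconstant monomial is kept by exactly one summand, that of its least variable. The
constant monomial is kept by none. -/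
theorem sum_monomialProj_min [LinearOrder V] [Fintype V] {f : MvPolynomial V k}
    (hf : constantCoeff f = 0) :
    ∑ v, monomialProj (fun m : V →₀ ℕ => v ∈ m.support ∧ ∀ u ∈ m.support, v ≤ u) f = f := by
  classical
  ext m
  rw [coeff_sum]
  simp only [coeff_monomialProj]
  by_cases hm : m = 0
  · subst hm
    rw [constantCoeff_eq] at hf
    simp [hf]
  · have hne : m.support.Nonempty := Finsupp.support_nonempty_iff.2 hm
    rw [Finset.sum_eq_single (m.support.min' hne)]
    · rw [if_pos ⟨Finset.min'_mem _ _, fun u hu => Finset.min'_le _ _ hu⟩]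
    · intro v _ hv
      rw [if_neg]
      rintro ⟨h1, h2⟩
      exact hv (le_antisymm (h2 _ (Finset.min'_mem _ _)) (Finset.min'_le _ _ h1))
    · simp

end RaisesSupport

/-! ### The cochain complex of the full simplex -/

section Simplex

variable {V : Type u} [LinearOrder V] {A : Type*} [AddCommGroup A]

/-- The simplicial coboundary on the full simplex, with coefficients in `A`. -/
def simplexD (F : Finset V → A) (τ : Finset V) : A :=
  ∑ v ∈ τ, vertexSign τ v • F (τ.erase v)

theorem vertexSign_mul_self (τ : Finset V) (v : V) : vertexSign τ v * vertexSign τ v = 1 := by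
  rw [vertexSign, ← mul_pow]
  simp

theorem vertexSign_insert_self {τ : Finset V} {v : V} :
    vertexSign (insert v τ) v = vertexSign τ v := by
  rw [vertexSign, vertexSign, Finset.filter_insert, if_neg (lt_irrefl v)]

theorem vertexSign_insert_of_lt {τ : Finset V} {u v : V} (h : u < v) :
    vertexSign (insert v τ) u = vertexSign τ u := by
  rw [vertexSign, vertexSign, Finset.filter_insert, if_neg h.not_gt]

theorem vertexSign_insert_of_gt {τ : Finset V} {u v : V} (hv : v ∉ τ) (h : v < u) :
    vertexSign (insert v τ) u = -vertexSign τ u := by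
  rw [vertexSign, vertexSign, Finset.filter_insert, if_pos h, Finset.card_insert_of_notMem (by
    simp [hv]), pow_succ]
  ring

theorem vertexSign_erase_of_lt {τ : Finset V} {u v : V} (h : u < v) :
    vertexSign (τ.erase v) u = vertexSign τ u := by
  by_cases hv : v ∈ τ
  · conv_rhs => rw [← Finset.insert_erase hv]
    rw [vertexSign_insert_of_lt h]
  · rw [Finset.erase_eq_of_notMem hv]

theorem vertexSign_erase_of_gt {τ : Finset V} {u v : V} (hv : v ∈ τ) (h : v < u) :
    vertexSign (τ.erase v) u = -vertexSign τ u := by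
  conv_rhs => rw [← Finset.insert_erase hv]
  rw [vertexSign_insert_of_gt (Finset.notMem_erase v τ) h, neg_neg]

/-- The terms are indexed by ordered pairs of removed vertices; exchanging the two removals reverses
the sign. -/
theorem simplexD_simplexD (F : Finset V → A) (τ : Finset V) : simplexD (simplexD F) τ = 0 := by
  have h : simplexD (simplexD F) τ = ∑ p ∈ τ.offDiag,
      (vertexSign τ p.1 * vertexSign (τ.erase p.1) p.2) • F ((τ.erase p.1).erase p.2) := by
    simp only [simplexD, Finset.smul_sum, smul_smul]
    rw [Finset.sum_sigma']
    refine Finset.sum_bij' (fun p _ => (p.1, p.2)) (fun p _ => ⟨p.1, p.2⟩) ?_ ?_ ?_ ?_ ?_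
    · rintro ⟨a, b⟩ hp
      simp only [Finset.mem_sigma, Finset.mem_erase] at hp
      exact Finset.mem_offDiag.2 ⟨hp.1, hp.2.2, hp.2.1.symm⟩
    · rintro ⟨a, b⟩ hp
      rw [Finset.mem_offDiag] at hp
      simp only [Finset.mem_sigma, Finset.mem_erase]
      exact ⟨hp.1, hp.2.2.symm, hp.2.1⟩
    · simp
    · simp
    · simp
  rw [h]
  refine Finset.sum_involution (fun p _ => p.swap) ?_ ?_ ?_ ?_
  · rintro ⟨a, b⟩ hp
    obtain ⟨ha, hb, hab⟩ := Finset.mem_offDiag.1 hp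
    simp only [Prod.swap] at *
    rw [Finset.erase_right_comm (a := b), ← add_smul]
    suffices vertexSign τ a * vertexSign (τ.erase a) b +
        vertexSign τ b * vertexSign (τ.erase b) a = 0 by rw [this, zero_smul]
    rcases lt_or_gt_of_ne hab with h | h
    · rw [vertexSign_erase_of_gt ha h, vertexSign_erase_of_lt h]; ring
    · rw [vertexSign_erase_of_gt hb h, vertexSign_erase_of_lt h]; ring
  · rintro ⟨a, b⟩ hp _ heq
    exact (Finset.mem_offDiag.1 hp).2.2 (congrArg Prod.fst heq).symm
  · rintro ⟨a, b⟩ hp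
    obtain ⟨ha, hb, hab⟩ := Finset.mem_offDiag.1 hp
    exact Finset.mem_offDiag.2 ⟨hb, ha, hab.symm⟩
  · rintro ⟨a, b⟩ hp
    rfl

/-- The cone operator with apex `v`, twisted by an endomorphism `g` of the coefficients. -/
def simplexH (v : V) (g : A → A) (F : Finset V → A) (τ : Finset V) : A :=
  if v ∈ τ then 0 else vertexSign τ v • g (F (insert v τ))

/-- The full simplex is a cone over `v`, which contracts its cochain complex. An additive `g` on the
coefficients just passes through. If `v ∈ τ` only the removal of `v` contributes; otherwise the
removals of the other vertices cancel in pairs. -/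
theorem simplexD_simplexH_add (v : V) (g : A →+ A) (F : Finset V → A) (τ : Finset V) :
    simplexD (simplexH v g F) τ + simplexH v g (simplexD F) τ = g (F τ) := by
  by_cases hv : v ∈ τ
  · rw [simplexH, if_pos hv, add_zero, simplexD, Finset.sum_eq_single v]
    · rw [simplexH, if_neg (Finset.notMem_erase v τ), Finset.insert_erase hv,
        ← vertexSign_insert_self (τ := τ.erase v), Finset.insert_erase hv, smul_smul,
        vertexSign_mul_self, one_smul]
    · intro u _ huv
      rw [simplexH, if_pos (Finset.mem_erase.2 ⟨huv.symm, hv⟩), smul_zero]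
    · exact fun h => absurd hv h
  · rw [simplexH, if_neg hv, simplexD, simplexD, Finset.sum_insert hv, Finset.erase_insert hv,
      map_add, smul_add, map_zsmul, smul_smul, vertexSign_insert_self, vertexSign_mul_self,
      one_smul, map_sum, Finset.smul_sum, add_left_comm, ← Finset.sum_add_distrib,
      Finset.sum_eq_zero, add_zero]
    intro u hu
    have huv : u ≠ v := fun h => hv (h ▸ hu)
    rw [simplexH, if_neg fun h => hv (Finset.mem_of_mem_erase h), map_zsmul, smul_smul, smul_smul,
      ← Finset.erase_insert_of_ne huv.symm, ← add_smul]
    suffices vertexSign τ u * vertexSign (τ.erase u) v +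
        vertexSign τ v * vertexSign (insert v τ) u = 0 by rw [this, zero_smul]
    rcases lt_or_gt_of_ne huv with h | h
    · rw [vertexSign_erase_of_gt hu h, vertexSign_insert_of_lt h]; ring
    · rw [vertexSign_erase_of_lt h, vertexSign_insert_of_gt hv h]; ring

end Simplex

/-! ### The partition complex -/

section PartitionComplex

variable {k : Type w} [Field k] {V : Type u} [LinearOrder V] {Ψ : RelativeComplex V}

/-- A family of polynomials, indexed by all finite sets, that represents elements of all the terms
of the partition complex. -/
def IsRep (Ψ : RelativeComplex V) (F : Finset V → MvPolynomial V k) : Prop :=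
  ∀ τ, F τ ∈ nonfaceIdeal k (Ψ.star τ).Γ

/-- The element of `P^p` that is represented by a family of polynomials. -/
def partitionMk (p : ℤ) (F : Finset V → MvPolynomial V k) (hF : IsRep Ψ F) :
    PartitionTerm k Ψ p :=
  fun τ => FaceModule.mk k (Ψ.star τ.1) (F τ.1) (hF τ.1)

theorem exists_partitionMk {p : ℤ} (z : PartitionTerm k Ψ p) :
    ∃ F hF, z = partitionMk p F hF := by
  classical
  choose f hf hz using fun τ => FaceModule.exists_mk (z τ)
  refine ⟨fun τ => if h : τ ∈ Ψ.Δ ∧ (τ.card : ℤ) - 1 = p then f ⟨τ, h⟩ else 0, fun τ => ?_, ?_⟩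
  · dsimp only
    split_ifs with h
    · exact hf ⟨τ, h⟩
    · exact zero_mem _
  · ext τ
    refine (hz τ).trans (FaceModule.mk_eq_mk_iff.2 ?_)
    dsimp only
    rw [dif_pos τ.2, sub_self]
    exact zero_mem _

theorem partitionMk_eq_iff {p : ℤ} {F G : Finset V → MvPolynomial V k} {hF : IsRep Ψ F}
    {hG : IsRep Ψ G} : partitionMk p F hF = partitionMk p G hG ↔
      ∀ τ ∈ Ψ.Δ, (τ.card : ℤ) - 1 = p → F τ - G τ ∈ nonfaceIdeal k (Ψ.star τ).Δ := by
  rw [funext_iff]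
  simp only [partitionMk, FaceModule.mk_eq_mk_iff]
  exact ⟨fun h τ h1 h2 => h ⟨τ, h1, h2⟩, fun h τ => h τ.1 τ.2.1 τ.2.2⟩

theorem partitionMk_congr {p : ℤ} {F G : Finset V → MvPolynomial V k} (hF : IsRep Ψ F)
    (h : ∀ τ, F τ = G τ) : partitionMk p F hF = partitionMk p G ((funext h : F = G) ▸ hF) :=
  partitionMk_eq_iff.2 fun τ _ _ => by rw [h, sub_self]; exact zero_mem _

theorem isRep_simplexD {F : Finset V → MvPolynomial V k} (hF : IsRep Ψ F) :
    IsRep Ψ (simplexD F) := fun τ =>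
  sum_mem fun v _ => zsmul_mem (nonfaceIdeal_antitone k
    (Ψ.star_Γ_le (Finset.erase_subset v τ)) (hF _)) _

theorem partitionD_mk {p q : ℤ} (h : q = p + 1) {F : Finset V → MvPolynomial V k}
    (hF : IsRep Ψ F) :
    partitionD k Ψ h (partitionMk p F hF) = partitionMk q (simplexD F) (isRep_simplexD hF) := by
  ext τ
  have h1 : partitionD k Ψ h (partitionMk p F hF) τ = ∑ v : {v // v ∈ τ.1},
      FaceModule.mk k (Ψ.star τ.1) (vertexSign τ.1 v.1 • F (τ.1.erase v))
        (zsmul_mem (nonfaceIdeal_antitone k (Ψ.star_Γ_le (Finset.erase_subset _ _)) (hF _)) _) := by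
    rw [partitionD, LinearMap.pi_apply, LinearMap.sum_apply]
    rfl
  rw [h1, FaceModule.sum_mk, partitionMk, FaceModule.mk_eq_mk_iff, simplexD,
    Finset.sum_coe_sort τ.1 (fun v => vertexSign τ.1 v • F (τ.1.erase v)), sub_self]
  exact zero_mem _

theorem partitionD_partitionD {p q r : ℤ} (h : q = p + 1) (h' : r = q + 1)
    (z : PartitionTerm k Ψ p) : partitionD k Ψ h' (partitionD k Ψ h z) = 0 := by
  obtain ⟨F, hF, rfl⟩ := exists_partitionMk z
  rw [partitionD_mk, partitionD_mk]
  ext τ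
  rw [partitionMk, Pi.zero_apply, FaceModule.mk_eq_zero_iff, simplexD_simplexD]
  exact zero_mem _

theorem isRep_smul (r : MvPolynomial V k) {F : Finset V → MvPolynomial V k} (hF : IsRep Ψ F) :
    IsRep Ψ fun τ => r * F τ := fun τ => Ideal.mul_mem_left _ r (hF τ)

theorem smul_partitionMk {p : ℤ} (r : MvPolynomial V k) {F : Finset V → MvPolynomial V k}
    (hF : IsRep Ψ F) : r • partitionMk p F hF = partitionMk p _ (isRep_smul r hF) := rfl

/-! #### Projections to the graded pieces -/

/-- The projection of `P^p` to its piece of degree `j`. -/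
def partitionProj (k : Type w) [Field k] (Ψ : RelativeComplex V) (p : ℤ) (j : ℕ) :
    PartitionTerm k Ψ p →ₗ[k] PartitionTerm k Ψ p :=
  LinearMap.pi fun τ => (FaceModule.proj (Ψ.star τ.1) j).comp (LinearMap.proj τ)

theorem partitionProj_apply {p : ℤ} (j : ℕ) (z : PartitionTerm k Ψ p) (τ : Ψ.AmbientFace p) :
    partitionProj k Ψ p j z τ = FaceModule.proj (Ψ.star τ.1) j (z τ) := rfl

theorem partitionProj_mem {p : ℤ} (j : ℕ) (z : PartitionTerm k Ψ p) :
    partitionProj k Ψ p j z ∈ partitionPiece k Ψ p j :=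
  fun _ _ => FaceModule.proj_mem j _

theorem partitionProj_of_mem {p : ℤ} {j : ℕ} {z : PartitionTerm k Ψ p}
    (hz : z ∈ partitionPiece k Ψ p j) : partitionProj k Ψ p j z = z :=
  funext fun τ => FaceModule.proj_of_mem (hz τ trivial)

theorem isRep_homogeneousComponent (j : ℕ) {F : Finset V → MvPolynomial V k} (hF : IsRep Ψ F) :
    IsRep Ψ fun τ => homogeneousComponent j (F τ) :=
  fun τ => homogeneousComponent_mem_nonfaceIdeal k j (hF τ)

theorem partitionProj_mk {p : ℤ} (j : ℕ) {F : Finset V → MvPolynomial V k} (hF : IsRep Ψ F) :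
    partitionProj k Ψ p j (partitionMk p F hF) =
      partitionMk p _ (isRep_homogeneousComponent j hF) := rfl

theorem partitionProj_partitionD {p q : ℤ} (h : q = p + 1) (j : ℕ) (z : PartitionTerm k Ψ p) :
    partitionProj k Ψ q j (partitionD k Ψ h z) = partitionD k Ψ h (partitionProj k Ψ p j z) := by
  obtain ⟨F, hF, rfl⟩ := exists_partitionMk z
  rw [partitionD_mk, partitionProj_mk, partitionProj_mk, partitionD_mk]
  refine partitionMk_congr _ fun τ => ?_
  simp only [simplexD, map_sum, map_zsmul]

theorem partitionD_mem_piece {p q : ℤ} (h : q = p + 1) {j : ℕ} {z : PartitionTerm k Ψ p}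
    (hz : z ∈ partitionPiece k Ψ p j) : partitionD k Ψ h z ∈ partitionPiece k Ψ q j := by
  rw [← partitionProj_of_mem hz, ← partitionProj_partitionD]
  exact partitionProj_mem _ _

theorem partitionProj_smul_succ {p : ℤ} {θ : MvPolynomial V k} (hθ : θ.IsHomogeneous 1) (j : ℕ)
    (z : PartitionTerm k Ψ p) :
    partitionProj k Ψ p (j + 1) (θ • z) = θ • partitionProj k Ψ p j z := by
  ext τ
  rw [add_comm, partitionProj_apply, Pi.smul_apply, FaceModule.proj_add_smul hθ]
  rfl

theorem partitionProj_smul_zero {p : ℤ} {θ : MvPolynomial V k} (hθ : θ.IsHomogeneous 1)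
    (z : PartitionTerm k Ψ p) : partitionProj k Ψ p 0 (θ • z) = 0 :=
  funext fun _ => FaceModule.proj_smul_of_lt hθ one_pos _

theorem smul_mem_partitionPiece {p : ℤ} {θ : MvPolynomial V k} (hθ : θ.IsHomogeneous 1) {j : ℕ}
    {z : PartitionTerm k Ψ p} (hz : z ∈ partitionPiece k Ψ p j) :
    θ • z ∈ partitionPiece k Ψ p (j + 1) := by
  rw [← partitionProj_of_mem hz, ← partitionProj_smul_succ hθ]
  exact partitionProj_mem _ _

instance [Finite V] (j : ℕ) : Module.Finite k (homogeneousSubmodule V k j) := by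
  have hfin : {d : V →₀ ℕ | d.degree = j}.Finite :=
    (Finsupp.finite_of_degree_le j).subset fun d hd => (hd : d.degree = j).le
  have : Submodule.span k ((fun d => monomial d (1 : k)) '' {d : V →₀ ℕ | d.degree = j}) =
      homogeneousSubmodule V k j := by
    refine le_antisymm (Submodule.span_le.2 ?_) fun f hf => ?_
    · rintro _ ⟨d, hd, rfl⟩
      exact isHomogeneous_monomial 1 hd
    · rw [f.as_sum]
      refine sum_mem fun d hd => ?_
      rw [← mul_one (coeff d f), ← smul_eq_mul, ← smul_monomial]
      refine Submodule.smul_mem _ _ (Submodule.subset_span ⟨d, ?_, rfl⟩)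
      rw [Set.mem_ofPred_eq, Finsupp.degree_eq_weight_one]
      exact hf (mem_support_iff.1 hd)
  rw [← this]
  exact Module.Finite.iff_fg.2 (Submodule.fg_span (hfin.image _))

instance [Finite V] (Ω : RelativeComplex V) (j : ℕ) : Module.Finite k (faceModulePiece k Ω j) := by
  have : Module.Finite k ((homogeneousSubmodule V k j).comap
      ((nonfaceIdeal k Ω.Γ).subtype.restrictScalars k)) :=
    Module.Finite.of_injective
      (((nonfaceIdeal k Ω.Γ).subtype.restrictScalars k).restrict
        (p := (homogeneousSubmodule V k j).comap ((nonfaceIdeal k Ω.Γ).subtype.restrictScalars k))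
        (q := homogeneousSubmodule V k j) fun x hx => hx)
      fun x y hxy => by
        have h := congrArg Subtype.val hxy
        exact Subtype.ext (Subtype.ext h)
  exact Module.Finite.map _ _

instance [Finite V] (p : ℤ) (j : ℕ) : Module.Finite k (partitionPiece k Ψ p j) :=
  Module.Finite.of_injective
    (LinearMap.pi fun τ => ((LinearMap.proj τ).restrict
      (p := partitionPiece k Ψ p j) (q := faceModulePiece k (Ψ.star τ.1) j)
      fun _ hx => hx τ trivial) :
      partitionPiece k Ψ p j →ₗ[k] ∀ τ : Ψ.AmbientFace p, faceModulePiece k (Ψ.star τ.1) j)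
    fun _ _ hxy => Subtype.ext (funext fun τ => congrArg Subtype.val (congrFun hxy τ))

/-! #### Contracting homotopies -/

/-- If `σ ∪ {v}` lies in the star of `τ`, then `σ` lies in the star of `τ ∪ {v}`, as both say that
`τ ∪ {v} ∪ σ` is a face. This makes the cone operator well defined on face modules. -/
theorem RaisesSupport.star_Γ {v : V} {g : MvPolynomial V k →ₗ[k] MvPolynomial V k}
    (hg : RaisesSupport v g) (τ : Finset V) :
    ∀ f ∈ nonfaceIdeal k (Ψ.star (insert v τ)).Γ, g f ∈ nonfaceIdeal k (Ψ.star τ).Γ :=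
  hg _ _ fun σ hσ => ⟨Ψ.Γ.lower (Finset.subset_insert v σ) hσ.1, by
    rw [Finset.insert_union, ← Finset.union_insert]; exact hσ.2⟩

theorem RaisesSupport.star_Δ {v : V} {g : MvPolynomial V k →ₗ[k] MvPolynomial V k}
    (hg : RaisesSupport v g) (τ : Finset V) :
    ∀ f ∈ nonfaceIdeal k (Ψ.star (insert v τ)).Δ, g f ∈ nonfaceIdeal k (Ψ.star τ).Δ :=
  hg _ _ fun σ hσ => ⟨Ψ.Δ.lower (Finset.subset_insert v σ) hσ.1, by
    rw [Finset.insert_union, ← Finset.union_insert]; exact hσ.2⟩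

/-- When `τ ∪ {v}` is not in `Δ` there is no summand to cone from, and `partitionH` is zero. The
simplex formula agrees: every support in `g f` contains `v`, hence is a non-face of the star of `τ`.
-/
theorem RaisesSupport.mem_of_notMem {v : V} {g : MvPolynomial V k →ₗ[k] MvPolynomial V k}
    (hg : RaisesSupport v g) {τ : Finset V} (hτ : insert v τ ∉ Ψ.Δ) (f : MvPolynomial V k) :
    g f ∈ nonfaceIdeal k (Ψ.star τ).Δ :=
  hg ⊥ _ (fun σ (hσ : insert v σ ∈ (Ψ.star τ).Δ) => by
    have hsub : insert v τ ⊆ τ ∪ insert v σ := by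
      rw [Finset.union_insert]; exact Finset.insert_subset_insert _ Finset.subset_union_left
    exact absurd (Ψ.Δ.lower hsub hσ.2) hτ) f (mem_nonfaceIdeal_iff.2 fun _ _ h => h)

theorem RaisesSupport.isRep {v : V} {g : MvPolynomial V k →ₗ[k] MvPolynomial V k}
    (hg : RaisesSupport v g) {F : Finset V → MvPolynomial V k} (hF : IsRep Ψ F) :
    IsRep Ψ fun τ => g (F τ) :=
  fun τ => hg _ _ (fun σ hσ => (Ψ.star τ).Γ.lower (Finset.subset_insert v σ) hσ) _ (hF τ)

theorem RaisesSupport.isRep_simplexH {v : V} {g : MvPolynomial V k →ₗ[k] MvPolynomial V k}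
    (hg : RaisesSupport v g) {F : Finset V → MvPolynomial V k} (hF : IsRep Ψ F) :
    IsRep Ψ (simplexH v g F) := fun τ => by
  rw [simplexH]
  split_ifs
  · exact zero_mem _
  · exact zsmul_mem (hg.star_Γ τ _ (hF _)) _

open scoped Classical in
/-- The homotopy `P^q → P^p` that is given by an endomorphism of the polynomial ring. -/
def partitionH {v : V} {g : MvPolynomial V k →ₗ[k] MvPolynomial V k} (hg : RaisesSupport v g)
    (Ψ : RelativeComplex V) {p q : ℤ} (h : q = p + 1) :
    PartitionTerm k Ψ q →ₗ[k] PartitionTerm k Ψ p :=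
  LinearMap.pi fun τ => if hv : v ∉ τ.1 ∧ insert v τ.1 ∈ Ψ.Δ then
    vertexSign τ.1 v • (FaceModule.map g (hg.star_Γ τ.1) (hg.star_Δ τ.1)).comp
      (LinearMap.proj (⟨insert v τ.1, hv.2, by
        have := τ.2.2
        rw [Finset.card_insert_of_notMem hv.1]
        push_cast
        omega⟩ : Ψ.AmbientFace q))
    else 0

theorem partitionH_mk {v : V} {g : MvPolynomial V k →ₗ[k] MvPolynomial V k}
    (hg : RaisesSupport v g) {p q : ℤ} (h : q = p + 1) {F : Finset V → MvPolynomial V k}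
    (hF : IsRep Ψ F) :
    partitionH hg Ψ h (partitionMk q F hF) = partitionMk p _ (hg.isRep_simplexH hF) := by
  ext τ
  rw [partitionH, LinearMap.pi_apply]
  split_ifs with hv
  · refine Eq.trans (b := FaceModule.mk k (Ψ.star τ.1) (vertexSign τ.1 v • g (F (insert v τ.1)))
      (zsmul_mem (hg.star_Γ τ.1 _ (hF _)) _)) rfl ?_
    rw [partitionMk, FaceModule.mk_eq_mk_iff, simplexH, if_neg hv.1, sub_self]
    exact zero_mem _
  · rw [LinearMap.zero_apply, eq_comm, partitionMk, FaceModule.mk_eq_zero_iff, simplexH]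
    split_ifs with hvτ
    · exact zero_mem _
    · exact zsmul_mem (hg.mem_of_notMem (fun hm => hv ⟨hvτ, hm⟩) _) _

/-- The homotopy formula, for representing families. -/
theorem partitionD_partitionH_add {v : V} {g : MvPolynomial V k →ₗ[k] MvPolynomial V k}
    (hg : RaisesSupport v g) {p q r : ℤ} (h : q = p + 1) (h' : r = q + 1)
    {F : Finset V → MvPolynomial V k} (hF : IsRep Ψ F) :
    partitionD k Ψ h (partitionH hg Ψ h (partitionMk q F hF)) +
      partitionH hg Ψ h' (partitionD k Ψ h' (partitionMk q F hF)) =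
      partitionMk q _ (hg.isRep hF) := by
  rw [partitionH_mk, partitionD_mk, partitionD_mk, partitionH_mk]
  ext τ
  have hτ : simplexD (simplexH v g F) τ.1 + simplexH v g (simplexD F) τ.1 = g (F τ.1) :=
    simplexD_simplexH_add v g.toAddMonoidHom F τ.1
  rw [Pi.add_apply, partitionMk, partitionMk, partitionMk, FaceModule.mk_add,
    FaceModule.mk_eq_mk_iff, hτ, sub_self]
  exact zero_mem _

theorem partitionH_smul {v : V} {g : MvPolynomial V k →ₗ[k] MvPolynomial V k}
    (hg : RaisesSupport v g) (hlin : ∀ r f, g (r * f) = r * g f) {p q : ℤ} (h : q = p + 1)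
    (r : MvPolynomial V k) (z : PartitionTerm k Ψ q) :
    partitionH hg Ψ h (r • z) = r • partitionH hg Ψ h z := by
  obtain ⟨F, hF, rfl⟩ := exists_partitionMk z
  rw [smul_partitionMk, partitionH_mk, partitionH_mk, smul_partitionMk]
  refine partitionMk_congr _ fun τ => ?_
  simp only [simplexH]
  split_ifs
  · rw [mul_zero]
  · rw [hlin, mul_smul_comm]

/-- The variables act as zero on the homology of `P^* / J P^*`. -/
theorem X_smul_mem_of_partitionD_mem (J : Ideal (MvPolynomial V k)) {p q r : ℤ} (h : q = p + 1)
    (h' : r = q + 1) {z : PartitionTerm k Ψ q}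
    (hz : partitionD k Ψ h' z ∈
      (J • ⊤ : Submodule (MvPolynomial V k) (PartitionTerm k Ψ r))) (v : V) :
    (X v : MvPolynomial V k) • z ∈ LinearMap.range (partitionD k Ψ h) ⊔
      (J • ⊤ : Submodule (MvPolynomial V k) (PartitionTerm k Ψ q)) := by
  have hg := raisesSupport_mul_X (k := k) v
  -- Multiplication by `x_v` is linear over the polynomial ring, so its homotopy preserves `J P^*`
  -- and descends to the reduced complex.
  have key : ∀ y ∈ (J • ⊤ : Submodule (MvPolynomial V k) (PartitionTerm k Ψ r)),
      partitionH hg Ψ h' y ∈ (J • ⊤ : Submodule (MvPolynomial V k) (PartitionTerm k Ψ q)) := by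
    intro y hy
    refine Submodule.smul_induction_on hy (fun c hc y _ => ?_) fun a b ha hb => by
      rw [map_add]; exact add_mem ha hb
    rw [partitionH_smul hg fun r f => by simp [mul_left_comm]]
    exact Submodule.smul_mem_smul hc trivial
  have h1 := key _ hz
  obtain ⟨F, hF, rfl⟩ := exists_partitionMk z
  have h2 := partitionD_partitionH_add hg h h' hF
  have h3 : (X v : MvPolynomial V k) • partitionMk q F hF = partitionMk q _ (hg.isRep hF) := rfl
  rw [h3, ← h2]
  exact Submodule.add_mem_sup ⟨_, rfl⟩ h1

theorem smul_mem_of_partitionD_mem (J : Ideal (MvPolynomial V k)) {p q r : ℤ} (h : q = p + 1)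
    (h' : r = q + 1) {z : PartitionTerm k Ψ q}
    (hz : partitionD k Ψ h' z ∈
      (J • ⊤ : Submodule (MvPolynomial V k) (PartitionTerm k Ψ r)))
    {θ : MvPolynomial V k} (hθ : constantCoeff θ = 0) :
    θ • z ∈ LinearMap.range (partitionD k Ψ h) ⊔
      (J • ⊤ : Submodule (MvPolynomial V k) (PartitionTerm k Ψ q)) := by
  set N := LinearMap.range (partitionD k Ψ h) ⊔
      (J • ⊤ : Submodule (MvPolynomial V k) (PartitionTerm k Ψ q)) with hN
  -- The polynomials that multiply `z` into `N` form an ideal; it contains the variables, hence the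
  -- irrelevant ideal.
  exact ker_constantCoeff_le (P := N.comap (LinearMap.toSpanSingleton (MvPolynomial V k) _ z))
    (fun v => X_smul_mem_of_partitionD_mem J h h' hz v) hθ

/-- The partition complex is exact in positive degrees. -/
theorem mem_range_partitionD [Fintype V] {p q r : ℤ} (h : q = p + 1) (h' : r = q + 1) {j : ℕ}
    (hj : 0 < j) {z : PartitionTerm k Ψ q} (hz : z ∈ partitionPiece k Ψ q j)
    (hdz : partitionD k Ψ h' z = 0) : z ∈ LinearMap.range (partitionD k Ψ h) := by
  classical
  obtain ⟨F, hF, hzF⟩ := exists_partitionMk z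
  have hg : ∀ v, RaisesSupport (k := k) v
      (monomialProj fun m : V →₀ ℕ => v ∈ m.support ∧ ∀ u ∈ m.support, v ≤ u) :=
    fun v => raisesSupport_monomialProj fun m hm => hm.1
  have hG := isRep_homogeneousComponent j hF
  have hzG : z = partitionMk q _ hG := by
    rw [← partitionProj_mk j hF, ← hzF, partitionProj_of_mem hz]
  -- The decomposition by least variable writes the cycle as a sum of images under null-homotopic
  -- maps. These projections are only `k`-linear, which suffices for the unreduced complex.
  have hsum : z = ∑ v, partitionMk q _ ((hg v).isRep hG) := by
    ext τ
    rw [Finset.sum_apply]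
    simp only [partitionMk]
    rw [FaceModule.sum_mk, hzG, partitionMk, FaceModule.mk_eq_mk_iff, sum_monomialProj_min,
      sub_self]
    · exact zero_mem _
    · exact (IsPosHomogeneous.constantCoeff_eq_zero
        ⟨j, hj, homogeneousComponent_isHomogeneous j _⟩)
  rw [hsum]
  refine sum_mem fun v _ => ?_
  rw [← partitionD_partitionH_add (hg v) h h' hG, ← hzG, hdz, map_zero, add_zero]
  exact ⟨_, rfl⟩

end PartitionComplex

/-! ### Dimension counts -/

section Dimension

variable {k : Type*} [Field k] {X Y : Type*} [AddCommGroup X] [AddCommGroup Y] [Module k X]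
  [Module k Y]

theorem finrank_fst_add (T : Submodule k (X × Y)) [Module.Finite k T] {U : Submodule k X}
    {V₀ : Submodule k Y} (hU : ∀ x, x ∈ U ↔ ∃ y, (x, y) ∈ T) (hV₀ : ∀ y, y ∈ V₀ ↔ (0, y) ∈ T) :
    Module.finrank k U + Module.finrank k V₀ = Module.finrank k T := by
  have h := ((LinearMap.fst k X Y).domRestrict T).finrank_range_add_finrank_ker
  have h1 : LinearMap.range ((LinearMap.fst k X Y).domRestrict T) = U := by
    ext x
    rw [hU]
    constructor
    · rintro ⟨⟨⟨a, b⟩, hab⟩, rfl⟩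
      exact ⟨b, hab⟩
    · rintro ⟨y, hy⟩
      exact ⟨⟨(x, y), hy⟩, rfl⟩
  let g : V₀ →ₗ[k] LinearMap.ker ((LinearMap.fst k X Y).domRestrict T) :=
    { toFun := fun y => ⟨⟨(0, y.1), (hV₀ y.1).1 y.2⟩, rfl⟩
      map_add' := fun a b => by ext <;> simp
      map_smul' := fun a b => by ext <;> simp }
  have hg : Function.Bijective g := by
    constructor
    · intro a b hab
      exact Subtype.ext (congrArg (fun z => z.1.1.2) hab)
    · rintro ⟨⟨⟨a, b⟩, hab⟩, h0⟩
      have ha : a = 0 := h0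
      subst ha
      exact ⟨⟨b, (hV₀ b).2 hab⟩, rfl⟩
  rw [← h, h1, (LinearEquiv.ofBijective g hg).finrank_eq]

theorem finrank_snd_add (T : Submodule k (X × Y)) [Module.Finite k T] {U₀ : Submodule k X}
    {V : Submodule k Y} (hV : ∀ y, y ∈ V ↔ ∃ x, (x, y) ∈ T) (hU₀ : ∀ x, x ∈ U₀ ↔ (x, 0) ∈ T) :
    Module.finrank k V + Module.finrank k U₀ = Module.finrank k T := by
  have e : T ≃ₗ[k] T.map (LinearEquiv.prodComm k X Y).toLinearMap :=
    (LinearEquiv.prodComm k X Y).submoduleMap T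
  have hmem : ∀ x y, (y, x) ∈ T.map (LinearEquiv.prodComm k X Y).toLinearMap ↔ (x, y) ∈ T := by
    intro x y
    constructor
    · rintro ⟨⟨a, b⟩, hab, h⟩
      obtain ⟨rfl, rfl⟩ := Prod.ext_iff.1 h
      exact hab
    · exact fun h => ⟨(x, y), h, rfl⟩
  have := Module.Finite.equiv e
  rw [e.finrank_eq]
  exact finrank_fst_add _ (fun y => by simp only [hmem, hV]) fun x => by rw [hmem, hU₀]

/-- The pairs `(x, y)` in `W × W'` with `L x ≡ L' y` modulo `N` form a linear relation. Its two
projections have images `U`, `V` and kernels `V₀`, `U₀`, so its dimension is computed in two ways.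
-/
theorem finrank_relation {W : Submodule k X} {W' : Submodule k Y} [Module.Finite k W]
    [Module.Finite k W'] {Z : Type*} [AddCommGroup Z] [Module k Z] (L : X →ₗ[k] Z) (L' : Y →ₗ[k] Z)
    (N : Submodule k Z) {U U₀ : Submodule k X} {V V₀ : Submodule k Y}
    (hU : ∀ x, x ∈ U ↔ x ∈ W ∧ ∃ y ∈ W', L x - L' y ∈ N) (hU₀ : ∀ x, x ∈ U₀ ↔ x ∈ W ∧ L x ∈ N)
    (hV : ∀ y, y ∈ V ↔ y ∈ W' ∧ ∃ x ∈ W, L x - L' y ∈ N) (hV₀ : ∀ y, y ∈ V₀ ↔ y ∈ W' ∧ L' y ∈ N) :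
    Module.finrank k U + Module.finrank k V₀ = Module.finrank k V + Module.finrank k U₀ := by
  have hfin : Module.Finite k (W.prod W') :=
    Module.Finite.iff_fg.2 ((Module.Finite.iff_fg.1 ‹_›).prod (Module.Finite.iff_fg.1 ‹_›))
  have hmem : ∀ x y, (x, y) ∈ W.prod W' ⊓ N.comap (L.coprod (-L')) ↔
      x ∈ W ∧ y ∈ W' ∧ L x - L' y ∈ N := by
    intro x y
    simp [Submodule.mem_inf, Submodule.mem_prod, and_assoc, sub_eq_add_neg]
  rw [finrank_fst_add (W.prod W' ⊓ N.comap (L.coprod (-L'))),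
    finrank_snd_add (W.prod W' ⊓ N.comap (L.coprod (-L')))]
  · intro y
    simp only [hmem, hV]
    exact ⟨fun ⟨h, x, hx, h'⟩ => ⟨x, hx, h, h'⟩, fun ⟨x, hx, h, h'⟩ => ⟨h, x, hx, h'⟩⟩
  · intro x
    simp only [hmem, hU₀, map_zero, sub_zero, zero_mem, true_and]
  · intro x
    simp only [hmem, hU]
    exact ⟨fun ⟨h, y, hy, h'⟩ => ⟨y, h, hy, h'⟩, fun ⟨y, h, hy, h'⟩ => ⟨h, y, hy, h'⟩⟩
  · intro y
    simp only [hmem, hV₀, map_zero, zero_sub, zero_mem, true_and, neg_mem_iff]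

end Dimension

/-! ### Cycles and boundaries modulo an ideal -/

section Cycles

variable {k : Type w} [Field k] {V : Type u} [LinearOrder V] (Ψ : RelativeComplex V)
  (J : Ideal (MvPolynomial V k))

/-- The elements of degree `j` of `P^q` that are cycles modulo `J P^*`. -/
def cyclesMod {q r : ℤ} (h' : r = q + 1) (j : ℕ) : Submodule k (PartitionTerm k Ψ q) :=
  partitionPiece k Ψ q j ⊓ ((J • ⊤ : Submodule (MvPolynomial V k) (PartitionTerm k Ψ r)).comap
    (partitionD k Ψ h')).restrictScalars k

/-- The elements of degree `j` of `P^q` that are boundaries modulo `J P^*`. -/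
def boundariesMod {p q : ℤ} (h : q = p + 1) (j : ℕ) : Submodule k (PartitionTerm k Ψ q) :=
  partitionPiece k Ψ q j ⊓ (LinearMap.range (partitionD k Ψ h) ⊔
    (J • ⊤ : Submodule (MvPolynomial V k) (PartitionTerm k Ψ q))).restrictScalars k

variable {Ψ J}

theorem mem_cyclesMod {q r : ℤ} {h' : r = q + 1} {j : ℕ} {z : PartitionTerm k Ψ q} :
    z ∈ cyclesMod Ψ J h' j ↔ z ∈ partitionPiece k Ψ q j ∧
      partitionD k Ψ h' z ∈ (J • ⊤ : Submodule (MvPolynomial V k) (PartitionTerm k Ψ r)) :=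
  Iff.rfl

theorem mem_boundariesMod {p q : ℤ} {h : q = p + 1} {j : ℕ} {z : PartitionTerm k Ψ q} :
    z ∈ boundariesMod Ψ J h j ↔ z ∈ partitionPiece k Ψ q j ∧
      z ∈ LinearMap.range (partitionD k Ψ h) ⊔
        (J • ⊤ : Submodule (MvPolynomial V k) (PartitionTerm k Ψ q)) :=
  Iff.rfl

theorem partitionD_mem_smul_top {p q : ℤ} (h : q = p + 1) {z : PartitionTerm k Ψ p}
    (hz : z ∈ (J • ⊤ : Submodule (MvPolynomial V k) (PartitionTerm k Ψ p))) :
    partitionD k Ψ h z ∈ (J • ⊤ : Submodule (MvPolynomial V k) (PartitionTerm k Ψ q)) :=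
  Submodule.smul_top_le_comap_smul_top J (partitionD k Ψ h) hz

theorem mem_range_sup_iff {p q : ℤ} {h : q = p + 1} {z : PartitionTerm k Ψ q} :
    z ∈ LinearMap.range (partitionD k Ψ h) ⊔
        (J • ⊤ : Submodule (MvPolynomial V k) (PartitionTerm k Ψ q)) ↔
      ∃ y, z - partitionD k Ψ h y ∈
        (J • ⊤ : Submodule (MvPolynomial V k) (PartitionTerm k Ψ q)) := by
  rw [Submodule.mem_sup]
  constructor
  · rintro ⟨_, ⟨y, rfl⟩, n, hn, rfl⟩
    exact ⟨y, by rwa [add_sub_cancel_left]⟩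
  · rintro ⟨y, hy⟩
    exact ⟨_, ⟨y, rfl⟩, _, hy, add_sub_cancel _ _⟩

theorem boundariesMod_le_cyclesMod {p q r : ℤ} (h : q = p + 1) (h' : r = q + 1) (j : ℕ) :
    boundariesMod Ψ J h j ≤ cyclesMod Ψ J h' j := by
  intro z hz
  obtain ⟨y, hy⟩ := mem_range_sup_iff.1 (mem_boundariesMod.1 hz).2
  refine mem_cyclesMod.2 ⟨hz.1, ?_⟩
  have := partitionD_mem_smul_top h' hy
  rwa [map_sub, partitionD_partitionD, sub_zero] at this

instance [Finite V] {q r : ℤ} (h' : r = q + 1) (j : ℕ) : Module.Finite k (cyclesMod Ψ J h' j) :=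
  Submodule.finiteDimensional_inf_left _ _

/-- The homology piece is the image of the cycles modulo `J`, with kernel the boundaries modulo `J`.
All later counts can thus be made inside the finite dimensional pieces of `P^*` itself. -/
theorem finrank_reducedPartitionHomologyPiece_add [Finite V] (i : ℤ) (j : ℕ) :
    Module.finrank k (reducedPartitionHomologyPiece Ψ J i j) +
      Module.finrank k (boundariesMod Ψ J (sub_add_cancel i 1).symm j) =
      Module.finrank k (cyclesMod Ψ J (rfl : i + 1 = i + 1) j) := by
  set N := (J • ⊤ : Submodule (MvPolynomial V k) (PartitionTerm k Ψ i))
  set f := reducedPartitionD Ψ J (sub_add_cancel i 1).symm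
  set g := reducedPartitionD Ψ J (rfl : i + 1 = i + 1)
  have hcyc : ∀ z : PartitionTerm k Ψ i, N.mkQ z ∈ LinearMap.ker g ↔
      partitionD k Ψ (rfl : i + 1 = i + 1) z ∈
        (J • ⊤ : Submodule (MvPolynomial V k) (PartitionTerm k Ψ (i + 1))) := fun z => by
    rw [LinearMap.mem_ker]
    exact Submodule.Quotient.mk_eq_zero _
  have hbd : ∀ z : PartitionTerm k Ψ i, N.mkQ z ∈ LinearMap.range f ↔
      z ∈ LinearMap.range (partitionD k Ψ (sub_add_cancel i 1).symm) ⊔ N := fun z => by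
    rw [mem_range_sup_iff]
    constructor
    · rintro ⟨y, hy⟩
      obtain ⟨y, rfl⟩ := Submodule.mkQ_surjective _ y
      exact ⟨y, (Submodule.Quotient.eq _).1 hy.symm⟩
    · rintro ⟨y, hy⟩
      exact ⟨Submodule.Quotient.mk y, ((Submodule.Quotient.eq _).2 hy).symm⟩
  let φ : cyclesMod Ψ J (rfl : i + 1 = i + 1) j →ₗ[k] ReducedPartitionHomology Ψ J i :=
    (((LinearMap.range f).submoduleOf (LinearMap.ker g)).mkQ.restrictScalars k).comp
      (((N.mkQ.restrictScalars k).comp (cyclesMod Ψ J (rfl : i + 1 = i + 1) j).subtype).codRestrict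
        ((LinearMap.ker g).restrictScalars k) fun z => (hcyc z.1).2 z.2.2)
  have h := φ.finrank_range_add_finrank_ker
  have hrange : LinearMap.range φ = reducedPartitionHomologyPiece Ψ J i j := by
    ext x
    constructor
    · rintro ⟨z, rfl⟩
      exact ⟨⟨N.mkQ z.1, (hcyc z.1).2 z.2.2⟩, ⟨z.1, z.2.1, rfl⟩, rfl⟩
    · rintro ⟨⟨_, hy⟩, ⟨z, hz, rfl⟩, rfl⟩
      exact ⟨⟨z, hz, (hcyc z).1 hy⟩, rfl⟩
  have hker : LinearMap.ker φ = (boundariesMod Ψ J (sub_add_cancel i 1).symm j).submoduleOf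
      (cyclesMod Ψ J (rfl : i + 1 = i + 1) j) := by
    ext z
    have h1 : φ z = 0 ↔ N.mkQ z.1 ∈ LinearMap.range f := Submodule.Quotient.mk_eq_zero _
    rw [LinearMap.mem_ker, h1, hbd]
    exact ⟨fun hz => ⟨z.2.1, hz⟩, fun hz => hz.2⟩
  rw [hrange, hker, (Submodule.submoduleOfEquivOfLe
    (boundariesMod_le_cyclesMod (sub_add_cancel i 1).symm rfl j)).finrank_eq] at h
  exact h

end Cycles

/-! ### Adding a linear form -/

section Step

variable {k : Type w} [Field k] {V : Type u} [LinearOrder V] {Ψ : RelativeComplex V}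
  {J : Ideal (MvPolynomial V k)}

variable (Ψ J) in
/-- The submodules `J P^p` are graded. -/
def IsGradedOn : Prop :=
  ∀ (p : ℤ) (j : ℕ), ∀ x ∈ (J • ⊤ : Submodule (MvPolynomial V k) (PartitionTerm k Ψ p)),
    partitionProj k Ψ p j x ∈ (J • ⊤ : Submodule (MvPolynomial V k) (PartitionTerm k Ψ p))

theorem mem_sup_span_smul_top_iff {R M : Type*} [CommRing R] [AddCommGroup M] [Module R M]
    (J : Ideal R) (θ : R) (x : M) :
    x ∈ ((J ⊔ Ideal.span {θ}) • ⊤ : Submodule R M) ↔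
      ∃ y, x - θ • y ∈ (J • ⊤ : Submodule R M) := by
  rw [Submodule.sup_smul, Submodule.mem_sup]
  constructor
  · rintro ⟨n, hn, m, hm, rfl⟩
    rw [Submodule.ideal_span_singleton_smul] at hm
    obtain ⟨y, -, rfl⟩ := (Submodule.mem_smul_pointwise_iff_exists _ _ _).1 hm
    exact ⟨y, by rwa [add_sub_cancel_right]⟩
  · rintro ⟨y, hy⟩
    exact ⟨_, hy, _, Submodule.smul_mem_smul (Ideal.mem_span_singleton_self θ) trivial,
      sub_add_cancel _ _⟩

/-- The degree `j + 1` component of `x - θ y` is `x_{j+1} - θ y_j`, and its degree zero component is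
just `x_0`. -/
theorem IsGradedOn.sup (hJ : IsGradedOn Ψ J) {θ : MvPolynomial V k} (hθ : θ.IsHomogeneous 1) :
    IsGradedOn Ψ (J ⊔ Ideal.span {θ}) := by
  intro p j x hx
  rw [mem_sup_span_smul_top_iff] at hx ⊢
  obtain ⟨y, hy⟩ := hx
  have h1 := hJ p j _ hy
  cases j with
  | zero =>
    rw [map_sub, partitionProj_smul_zero hθ] at h1
    exact ⟨0, by simpa using h1⟩
  | succ j =>
    rw [map_sub, partitionProj_smul_succ hθ] at h1
    exact ⟨_, h1⟩

theorem isGradedOn_bot : IsGradedOn Ψ (⊥ : Ideal (MvPolynomial V k)) := by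
  intro p j x hx
  rw [Submodule.bot_smul, Submodule.mem_bot] at hx
  rw [hx, map_zero]
  exact zero_mem _

/-- The projection to degree `j` commutes with the differential and preserves `J P^*`, so the degree
`j` component of `y` serves as well. -/
theorem IsGradedOn.exists_mem_piece (hJ : IsGradedOn Ψ J) {p q : ℤ} (h : q = p + 1) {j : ℕ}
    {z : PartitionTerm k Ψ q} (hz : z ∈ partitionPiece k Ψ q j) {y : PartitionTerm k Ψ p}
    (hy : z - partitionD k Ψ h y ∈
      (J • ⊤ : Submodule (MvPolynomial V k) (PartitionTerm k Ψ q))) :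
    ∃ y ∈ partitionPiece k Ψ p j, z - partitionD k Ψ h y ∈
      (J • ⊤ : Submodule (MvPolynomial V k) (PartitionTerm k Ψ q)) := by
  have h1 := hJ q j _ hy
  rw [map_sub, partitionProj_of_mem hz, partitionProj_partitionD] at h1
  exact ⟨_, partitionProj_mem _ _, h1⟩

theorem IsGradedOn.exists_smul (hJ : IsGradedOn Ψ J) {q : ℤ} {θ : MvPolynomial V k}
    (hθ : θ.IsHomogeneous 1) {j : ℕ}
    {z : PartitionTerm k Ψ q} (hz : z ∈ partitionPiece k Ψ q (j + 1)) {y : PartitionTerm k Ψ q}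
    (hy : z - θ • y ∈ (J • ⊤ : Submodule (MvPolynomial V k) (PartitionTerm k Ψ q))) :
    ∃ y ∈ partitionPiece k Ψ q j, z - θ • y ∈
      (J • ⊤ : Submodule (MvPolynomial V k) (PartitionTerm k Ψ q)) := by
  have h1 := hJ q (j + 1) _ hy
  rw [map_sub, partitionProj_of_mem hz, partitionProj_smul_succ hθ] at h1
  exact ⟨_, partitionProj_mem _ _, h1⟩

/-- In degree zero nothing changes. -/
theorem IsGradedOn.cyclesMod_sup_zero (hJ : IsGradedOn Ψ J) {θ : MvPolynomial V k}
    (hθ : θ.IsHomogeneous 1) {q r : ℤ} (h' : r = q + 1) :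
    cyclesMod Ψ (J ⊔ Ideal.span {θ}) h' 0 = cyclesMod Ψ J h' 0 := by
  ext z
  rw [mem_cyclesMod, mem_cyclesMod, mem_sup_span_smul_top_iff]
  refine and_congr_right fun hz => ⟨?_, fun h => ⟨0, by simpa using h⟩⟩
  rintro ⟨y, hy⟩
  have h1 := hJ r 0 _ hy
  rwa [map_sub, partitionProj_of_mem (partitionD_mem_piece h' hz), partitionProj_smul_zero hθ,
    sub_zero] at h1

theorem IsGradedOn.boundariesMod_sup_zero (hJ : IsGradedOn Ψ J) {θ : MvPolynomial V k}
    (hθ : θ.IsHomogeneous 1) {p q : ℤ} (h : q = p + 1) :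
    boundariesMod Ψ (J ⊔ Ideal.span {θ}) h 0 = boundariesMod Ψ J h 0 := by
  ext z
  rw [mem_boundariesMod, mem_boundariesMod, mem_range_sup_iff, mem_range_sup_iff]
  refine and_congr_right fun hz => ⟨?_, ?_⟩
  · rintro ⟨y, hy⟩
    obtain ⟨x, hx⟩ := (mem_sup_span_smul_top_iff _ _ _).1 hy
    have h1 := hJ q 0 _ hx
    rw [map_sub, map_sub, partitionProj_of_mem hz, partitionProj_smul_zero hθ, sub_zero,
      partitionProj_partitionD] at h1
    exact ⟨_, h1⟩
  · rintro ⟨y, hy⟩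
    exact ⟨y, (mem_sup_span_smul_top_iff _ _ _).2 ⟨0, by simpa using hy⟩⟩

/-- The dimension count that replaces the long exact sequence for multiplication by `θ`. -/
theorem IsGradedOn.finrank_cyclesMod_sup [Finite V] (hJ : IsGradedOn Ψ J) {θ : MvPolynomial V k}
    (hθ : θ.IsHomogeneous 1) {p q r s : ℤ} (h : q = p + 1) (h' : r = q + 1) (h'' : s = r + 1)
    (hr : ∀ x : PartitionTerm k Ψ r,
      θ • x ∈ (J • ⊤ : Submodule (MvPolynomial V k) (PartitionTerm k Ψ r)) →
      x ∈ (J • ⊤ : Submodule (MvPolynomial V k) (PartitionTerm k Ψ r)))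
    (hs : ∀ x : PartitionTerm k Ψ s,
      θ • x ∈ (J • ⊤ : Submodule (MvPolynomial V k) (PartitionTerm k Ψ s)) →
      x ∈ (J • ⊤ : Submodule (MvPolynomial V k) (PartitionTerm k Ψ s))) (j : ℕ) :
    Module.finrank k (cyclesMod Ψ (J ⊔ Ideal.span {θ}) h' (j + 1)) +
        Module.finrank k (boundariesMod Ψ J h (j + 1)) + Module.finrank k (boundariesMod Ψ J h' j) =
      Module.finrank k (boundariesMod Ψ (J ⊔ Ideal.span {θ}) h (j + 1)) +
        Module.finrank k (cyclesMod Ψ J h' (j + 1)) + Module.finrank k (cyclesMod Ψ J h'' j) := by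
  have hθ0 : constantCoeff θ = 0 := IsPosHomogeneous.constantCoeff_eq_zero ⟨1, one_pos, hθ⟩
  -- Relation `dz ≡ θ y` modulo `J`. The possible `y` are exactly the cycles: `θ` kills homology, so
  -- `θ y` is a boundary; conversely `θ dy ≡ 0` forces `dy ≡ 0` by injectivity in degree `s`.
  have e1 : Module.finrank k (cyclesMod Ψ (J ⊔ Ideal.span {θ}) h' (j + 1)) +
      Module.finrank k ↥(partitionPiece k Ψ r j ⊓
        (J • ⊤ : Submodule (MvPolynomial V k) (PartitionTerm k Ψ r)).restrictScalars k) =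
      Module.finrank k (cyclesMod Ψ J h'' j) + Module.finrank k (cyclesMod Ψ J h' (j + 1)) := by
    refine finrank_relation (W := partitionPiece k Ψ q (j + 1)) (W' := partitionPiece k Ψ r j)
      ((partitionD k Ψ h').restrictScalars k)
      ((LinearMap.lsmul (MvPolynomial V k) (PartitionTerm k Ψ r) θ).restrictScalars k)
      ((J • ⊤ : Submodule (MvPolynomial V k) (PartitionTerm k Ψ r)).restrictScalars k) ?_ ?_ ?_ ?_
    · intro z
      rw [mem_cyclesMod, mem_sup_span_smul_top_iff]
      refine and_congr_right fun hz => ⟨?_, fun ⟨y, _, hy⟩ => ⟨y, hy⟩⟩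
      rintro ⟨y, hy⟩
      exact hJ.exists_smul hθ (partitionD_mem_piece h' hz) hy
    · intro z
      exact Iff.rfl
    · intro y
      rw [mem_cyclesMod]
      refine and_congr_right fun hy => ⟨fun hdy => ?_, ?_⟩
      · obtain ⟨x, hx⟩ := mem_range_sup_iff.1 (smul_mem_of_partitionD_mem J h' h'' hdy hθ0)
        obtain ⟨x, hx, hmem⟩ := hJ.exists_mem_piece h' (smul_mem_partitionPiece hθ hy) hx
        refine ⟨x, hx, ?_⟩
        rw [← neg_mem_iff, neg_sub]
        exact hmem
      · rintro ⟨x, -, hx⟩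
        have := partitionD_mem_smul_top h'' hx
        refine hs _ ?_
        rw [← neg_mem_iff]
        simpa [partitionD_partitionD] using this
    · intro y
      exact and_congr_right fun hy => ⟨fun h => Submodule.smul_mem _ θ h, hr y⟩
  -- The cycles `u` are exactly the elements for which `θ u` is a boundary: one direction because
  -- `θ` kills homology, the other by injectivity in degree `r`. Injectivity in degree `q` is not
  -- needed.
  have hZ : ∀ u : PartitionTerm k Ψ q, u ∈ cyclesMod Ψ J h' j ↔ u ∈ partitionPiece k Ψ q j ∧
      θ • u ∈ LinearMap.range (partitionD k Ψ h) ⊔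
        (J • ⊤ : Submodule (MvPolynomial V k) (PartitionTerm k Ψ q)) := by
    intro u
    rw [mem_cyclesMod]
    refine and_congr_right fun hu => ⟨fun hdu => smul_mem_of_partitionD_mem J h h' hdu hθ0, ?_⟩
    intro hmem
    obtain ⟨y, hy⟩ := mem_range_sup_iff.1 hmem
    have := partitionD_mem_smul_top h' hy
    refine hr _ ?_
    simpa [partitionD_partitionD] using this
  -- Relation `z ≡ θ u` modulo boundaries and `J`, with every `u` of degree `j` allowed.
  have e2 : Module.finrank k (boundariesMod Ψ (J ⊔ Ideal.span {θ}) h (j + 1)) +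
      Module.finrank k (cyclesMod Ψ J h' j) =
      Module.finrank k (partitionPiece k Ψ q j) +
        Module.finrank k (boundariesMod Ψ J h (j + 1)) := by
    refine finrank_relation (W := partitionPiece k Ψ q (j + 1)) (W' := partitionPiece k Ψ q j)
      LinearMap.id ((LinearMap.lsmul (MvPolynomial V k) (PartitionTerm k Ψ q) θ).restrictScalars k)
      ((LinearMap.range (partitionD k Ψ h) ⊔
        (J • ⊤ : Submodule (MvPolynomial V k) (PartitionTerm k Ψ q))).restrictScalars k) ?_ ?_ ?_ hZ
    · intro z
      rw [mem_boundariesMod, mem_range_sup_iff]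
      refine and_congr_right fun hz => ⟨?_, ?_⟩
      · rintro ⟨y, hy⟩
        obtain ⟨x, hx⟩ := (mem_sup_span_smul_top_iff _ _ _).1 hy
        have h1 := hJ q (j + 1) _ hx
        rw [map_sub, map_sub, partitionProj_of_mem hz, partitionProj_smul_succ hθ,
          partitionProj_partitionD, sub_right_comm] at h1
        exact ⟨_, partitionProj_mem _ _, mem_range_sup_iff.2 ⟨_, h1⟩⟩
      · rintro ⟨x, -, hx⟩
        obtain ⟨y, hy⟩ := mem_range_sup_iff.1 hx
        refine ⟨y, (mem_sup_span_smul_top_iff _ _ _).2 ⟨x, ?_⟩⟩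
        rw [sub_right_comm]
        exact hy
    · intro z
      exact Iff.rfl
    · intro u
      refine ⟨fun hu => ⟨hu, θ • u, smul_mem_partitionPiece hθ hu, ?_⟩, fun hu => hu.1⟩
      simp
  -- Relation `z ≡ du` modulo `J`: rank and nullity of the differential. It cancels the auxiliary
  -- dimensions in the other two counts.
  have e3 : Module.finrank k (boundariesMod Ψ J h' j) + Module.finrank k (cyclesMod Ψ J h' j) =
      Module.finrank k (partitionPiece k Ψ q j) +
        Module.finrank k ↥(partitionPiece k Ψ r j ⊓
          (J • ⊤ : Submodule (MvPolynomial V k) (PartitionTerm k Ψ r)).restrictScalars k) := by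
    refine finrank_relation (W := partitionPiece k Ψ r j) (W' := partitionPiece k Ψ q j)
      LinearMap.id ((partitionD k Ψ h').restrictScalars k)
      ((J • ⊤ : Submodule (MvPolynomial V k) (PartitionTerm k Ψ r)).restrictScalars k)
      ?_ ?_ ?_ ?_
    · intro z
      rw [mem_boundariesMod, mem_range_sup_iff]
      refine and_congr_right fun hz => ⟨?_, fun ⟨y, _, hy⟩ => ⟨y, hy⟩⟩
      rintro ⟨y, hy⟩
      exact hJ.exists_mem_piece h' hz hy
    · intro z
      exact Iff.rfl
    · intro u
      refine ⟨fun hu => ⟨hu, partitionD k Ψ h' u, partitionD_mem_piece h' hu, ?_⟩, fun hu => hu.1⟩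
      simp
    · intro u
      exact Iff.rfl
  omega

end Step

/-! ### Regularity on the terms of the partition complex -/

section Injectivity

open RingTheory.Sequence

variable {k : Type w} [Field k] {V : Type u} [LinearOrder V] {Ψ : RelativeComplex V}
  {J : Ideal (MvPolynomial V k)}

theorem mem_smul_top_pi_iff {R ι : Type*} [CommRing R] [Finite ι] {M : ι → Type*}
    [∀ i, AddCommGroup (M i)] [∀ i, Module R (M i)] (J : Ideal R) (x : ∀ i, M i) :
    x ∈ (J • ⊤ : Submodule R (∀ i, M i)) ↔ ∀ i, x i ∈ (J • ⊤ : Submodule R (M i)) := by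
  classical
  have := Fintype.ofFinite ι
  constructor
  · intro hx i
    exact Submodule.smul_top_le_comap_smul_top J (LinearMap.proj i : (∀ i, M i) →ₗ[R] M i) hx
  · intro hx
    have h : x = ∑ i, LinearMap.single R M i (x i) := (Finset.univ_sum_single x).symm
    rw [h]
    exact sum_mem fun i _ => Submodule.smul_top_le_comap_smul_top J (LinearMap.single R M i) (hx i)

theorem smul_mem_imp_of_isWeaklyRegular {R M : Type*} [CommRing R] [AddCommGroup M] [Module R M]
    {rs : List R} (h : IsWeaklyRegular M rs) {s : ℕ} (hs : s < rs.length) {x : M}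
    (hx : rs[s] • x ∈ (Ideal.ofList (rs.take s) • ⊤ : Submodule R M)) :
    x ∈ (Ideal.ofList (rs.take s) • ⊤ : Submodule R M) := by
  have h1 := (isWeaklyRegular_iff_Fin M rs).1 h ⟨s, hs⟩
  rw [isSMulRegular_iff_right_eq_zero_of_smul] at h1
  rw [← Submodule.Quotient.mk_eq_zero]
  refine h1 _ ?_
  rw [← Submodule.Quotient.mk_smul, Submodule.Quotient.mk_eq_zero]
  exact hx

theorem partition_smul_mem_imp [Finite V] {rs : List (MvPolynomial V k)}
    (h : ∀ τ ∈ Ψ.Δ, τ.Nonempty → IsWeaklyRegular (FaceModule k (Ψ.star τ)) rs) {s : ℕ}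
    (hs : s < rs.length) {p : ℤ} (hp : 0 ≤ p) (x : PartitionTerm k Ψ p)
    (hx : rs[s] • x ∈
      (Ideal.ofList (rs.take s) • ⊤ : Submodule (MvPolynomial V k) (PartitionTerm k Ψ p))) :
    x ∈ (Ideal.ofList (rs.take s) • ⊤ : Submodule (MvPolynomial V k) (PartitionTerm k Ψ p)) := by
  have := Finite.of_injective (fun τ : Ψ.AmbientFace p => τ.1) Subtype.val_injective
  rw [mem_smul_top_pi_iff] at hx ⊢
  intro τ
  -- The bound `0 ≤ p` excludes the empty face, for which no regularity is assumed.
  have hne : τ.1.Nonempty := by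
    rw [← Finset.card_pos]
    have := τ.2.2
    omega
  exact smul_mem_imp_of_isWeaklyRegular (h τ.1 τ.2.1 hne) hs (hx τ)

end Injectivity

/-! ### The piece of degree zero of the partition complex -/

section DegreeZero

section

variable {k : Type w} [Field k] {V : Type u} {Ψ : RelativeComplex V}

open scoped Classical in
/-- A cochain, extended by zero to all finite sets. -/
def extendCochain {p : ℤ} (a : Ψ.Face p → k) (τ : Finset V) : k :=
  if h : Ψ.IsFace τ ∧ (τ.card : ℤ) - 1 = p then a ⟨τ, h⟩ else 0

theorem extendCochain_apply {p : ℤ} (a : Ψ.Face p → k) (τ : Ψ.Face p) :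
    extendCochain a τ.1 = a τ :=
  dif_pos τ.2

theorem extendCochain_of_mem {p : ℤ} (a : Ψ.Face p → k) {τ : Finset V} (h : τ ∈ Ψ.Γ) :
    extendCochain a τ = 0 :=
  dif_neg fun h' => h'.1.2 h

end

variable {k : Type w} [Field k] {V : Type u} [LinearOrder V] {Ψ : RelativeComplex V}

theorem extendCochain_coboundary {p q : ℤ} (h : q = p + 1) (a : Ψ.Face p → k) {τ : Finset V}
    (hτ : τ ∈ Ψ.Δ) (hcard : (τ.card : ℤ) - 1 = q) :
    extendCochain (coboundary k Ψ h a) τ = simplexD (extendCochain a) τ := by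
  by_cases hΓ : τ ∈ Ψ.Γ
  · rw [extendCochain_of_mem _ hΓ, simplexD, Finset.sum_eq_zero]
    intro v _
    rw [extendCochain_of_mem a (Ψ.Γ.lower (Finset.erase_subset v τ) hΓ), smul_zero]
  · rw [extendCochain_apply _ (⟨τ, ⟨hτ, hΓ⟩, hcard⟩ : Ψ.Face q), coboundary, LinearMap.pi_apply,
      LinearMap.sum_apply, simplexD,
      ← Finset.sum_coe_sort τ (fun v => vertexSign τ v • extendCochain a (τ.erase v))]
    refine Finset.sum_congr rfl fun v _ => ?_
    split_ifs with hv
    · rw [extendCochain_of_mem a hv, smul_zero, LinearMap.zero_apply]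
    · rw [LinearMap.smul_apply, LinearMap.proj_apply]
      exact congrArg (vertexSign τ v • ·) (extendCochain_apply a _).symm

/-- If `τ ∉ Γ` then `st_τ Γ` is void and its non-face ideal is the whole ring; if `τ ∈ Γ` the
extended cochain vanishes. This is why degree zero of `P^*` sees exactly the faces of `Ψ`. -/
theorem isRep_extendCochain {p : ℤ} (a : Ψ.Face p → k) :
    IsRep Ψ fun τ => C (extendCochain a τ) := by
  intro τ
  by_cases hΓ : τ ∈ Ψ.Γ
  · dsimp only
    rw [extendCochain_of_mem a hΓ, C_0]
    exact zero_mem _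
  · exact mem_nonfaceIdeal_iff.2 fun m _ hm => hΓ (Ψ.Γ.lower Finset.subset_union_left hm.2)

/-- Cochains are elements of degree zero of the partition complex. -/
def cochainMap (k : Type w) [Field k] (Ψ : RelativeComplex V) (p : ℤ) :
    (Ψ.Face p → k) →ₗ[k] PartitionTerm k Ψ p where
  toFun a := partitionMk p _ (isRep_extendCochain a)
  map_add' a b := by
    ext τ
    refine FaceModule.mk_eq_mk_iff.2 ?_
    simp only [extendCochain]
    split_ifs <;> simp
  map_smul' c a := by
    ext τ
    refine FaceModule.mk_eq_mk_iff.2 ?_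
    simp only [extendCochain]
    split_ifs <;> simp [MvPolynomial.smul_eq_C_mul]

theorem cochainMap_apply {p : ℤ} (a : Ψ.Face p → k) :
    cochainMap k Ψ p a = partitionMk p _ (isRep_extendCochain a) := rfl

theorem cochainMap_injective (p : ℤ) : Function.Injective (cochainMap k Ψ p) := by
  intro a b hab
  ext τ
  rw [cochainMap_apply, cochainMap_apply] at hab
  have h := partitionMk_eq_iff.1 hab τ.1 τ.2.1.1 τ.2.2
  rw [extendCochain_apply, extendCochain_apply, ← C_sub, mem_nonfaceIdeal_iff] at h
  by_contra hne
  refine h 0 ?_ ?_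
  · rw [mem_support_iff, coeff_zero_C]
    exact sub_ne_zero.2 hne
  · rw [Finsupp.support_zero]
    exact ⟨Ψ.Δ.lower (Finset.empty_subset _) τ.2.1.1, by rw [Finset.union_empty]; exact τ.2.1.1⟩

theorem cochainMap_mem_piece {p : ℤ} (a : Ψ.Face p → k) :
    cochainMap k Ψ p a ∈ partitionPiece k Ψ p 0 := fun _ _ =>
  FaceModule.mem_faceModulePiece_iff.2 ⟨_, _, isHomogeneous_C _ _, rfl⟩

theorem exists_cochainMap_eq {p : ℤ} {z : PartitionTerm k Ψ p}
    (hz : z ∈ partitionPiece k Ψ p 0) : ∃ a, cochainMap k Ψ p a = z := by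
  obtain ⟨F, hF, hzF⟩ := exists_partitionMk z
  refine ⟨fun τ => coeff 0 (F τ.1), ?_⟩
  rw [← partitionProj_of_mem hz, hzF, partitionProj_mk, cochainMap_apply]
  refine partitionMk_eq_iff.2 fun τ hτ hcard => ?_
  rw [homogeneousComponent_zero]
  by_cases hΓ : τ ∈ Ψ.Γ
  · have h0 : coeff 0 (F τ) = 0 := by
      by_contra hne
      refine mem_nonfaceIdeal_iff.1 (hF τ) 0 (mem_support_iff.2 hne) ?_
      rw [Finsupp.support_zero]
      exact ⟨Ψ.Γ.lower (Finset.empty_subset _) hΓ, by rw [Finset.union_empty]; exact hΓ⟩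
    rw [extendCochain_of_mem _ hΓ, h0, sub_self]
    exact zero_mem _
  · rw [extendCochain_apply _ (⟨τ, ⟨hτ, hΓ⟩, hcard⟩ : Ψ.Face p), sub_self]
    exact zero_mem _

theorem partitionD_cochainMap {p q : ℤ} (h : q = p + 1) (a : Ψ.Face p → k) :
    partitionD k Ψ h (cochainMap k Ψ p a) = cochainMap k Ψ q (coboundary k Ψ h a) := by
  rw [cochainMap_apply, cochainMap_apply, partitionD_mk]
  refine partitionMk_eq_iff.2 fun τ hτ hcard => ?_
  rw [extendCochain_coboundary h a hτ hcard, simplexD, simplexD, map_sum, ← Finset.sum_sub_distrib]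
  refine sum_mem fun v _ => ?_
  rw [map_zsmul, sub_self]
  exact zero_mem _

theorem cyclesMod_bot_zero {q r : ℤ} (h' : r = q + 1) :
    cyclesMod Ψ (⊥ : Ideal (MvPolynomial V k)) h' 0 =
      (LinearMap.ker (coboundary k Ψ h')).map (cochainMap k Ψ q) := by
  ext z
  rw [mem_cyclesMod, Submodule.bot_smul, Submodule.mem_bot, Submodule.mem_map]
  constructor
  · rintro ⟨hz, hdz⟩
    obtain ⟨a, rfl⟩ := exists_cochainMap_eq hz
    rw [partitionD_cochainMap] at hdz
    exact ⟨a, cochainMap_injective _ (hdz.trans (map_zero _).symm), rfl⟩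
  · rintro ⟨a, ha, rfl⟩
    refine ⟨cochainMap_mem_piece a, ?_⟩
    rw [partitionD_cochainMap, LinearMap.mem_ker.1 ha, map_zero]

theorem boundariesMod_bot_zero {p q : ℤ} (h : q = p + 1) :
    boundariesMod Ψ (⊥ : Ideal (MvPolynomial V k)) h 0 =
      (LinearMap.range (coboundary k Ψ h)).map (cochainMap k Ψ q) := by
  ext z
  rw [mem_boundariesMod, Submodule.bot_smul, sup_bot_eq, Submodule.mem_map]
  constructor
  · rintro ⟨hz, y, rfl⟩
    obtain ⟨b, hb⟩ := exists_cochainMap_eq (partitionProj_mem 0 y)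
    refine ⟨_, ⟨b, rfl⟩, ?_⟩
    rw [← partitionD_cochainMap, hb, ← partitionProj_partitionD, partitionProj_of_mem hz]
  · rintro ⟨_, ⟨b, rfl⟩, rfl⟩
    exact ⟨cochainMap_mem_piece _, _, partitionD_cochainMap h b⟩

/-- Inherited from the partition complex through the injective chain map `cochainMap`. -/
theorem coboundary_coboundary {p q r : ℤ} (h : q = p + 1) (h' : r = q + 1) (a : Ψ.Face p → k) :
    coboundary k Ψ h' (coboundary k Ψ h a) = 0 := by
  apply cochainMap_injective r
  rw [← partitionD_cochainMap, ← partitionD_cochainMap, partitionD_partitionD, map_zero]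

theorem finrank_cohomology_add [Finite V] (i : ℤ) :
    Module.finrank k (Cohomology k Ψ i) +
      Module.finrank k (LinearMap.range (coboundary k Ψ (sub_add_cancel i 1).symm)) =
      Module.finrank k (LinearMap.ker (coboundary k Ψ (rfl : i + 1 = i + 1))) := by
  have hle : LinearMap.range (coboundary k Ψ (sub_add_cancel i 1).symm) ≤
      LinearMap.ker (coboundary k Ψ (rfl : i + 1 = i + 1)) := by
    rintro _ ⟨a, rfl⟩
    exact coboundary_coboundary _ _ a
  have := Finite.of_injective (fun τ : Ψ.Face i => τ.1) Subtype.val_injective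
  rw [← (Submodule.submoduleOfEquivOfLe hle).finrank_eq]
  exact Submodule.finrank_quotient_add_finrank _

theorem finrank_reducedPartitionHomologyPiece_bot_zero [Finite V] (i : ℤ) :
    Module.finrank k (reducedPartitionHomologyPiece Ψ (⊥ : Ideal (MvPolynomial V k)) i 0) =
      Module.finrank k (Cohomology k Ψ i) := by
  have h1 := finrank_reducedPartitionHomologyPiece_add (Ψ := Ψ)
    (J := (⊥ : Ideal (MvPolynomial V k))) i 0
  have h2 := finrank_cohomology_add (k := k) (Ψ := Ψ) i
  rw [cyclesMod_bot_zero, boundariesMod_bot_zero,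
    ← (Submodule.equivMapOfInjective _ (cochainMap_injective i) _).finrank_eq,
    ← (Submodule.equivMapOfInjective _ (cochainMap_injective i) _).finrank_eq] at h1
  omega

theorem finrank_reducedPartitionHomologyPiece_bot_succ [Fintype V] (i : ℤ) (j : ℕ) :
    Module.finrank k (reducedPartitionHomologyPiece Ψ (⊥ : Ideal (MvPolynomial V k)) i (j + 1)) =
      0 := by
  have h1 := finrank_reducedPartitionHomologyPiece_add (Ψ := Ψ)
    (J := (⊥ : Ideal (MvPolynomial V k))) i (j + 1)
  have h2 : boundariesMod Ψ (⊥ : Ideal (MvPolynomial V k)) (sub_add_cancel i 1).symm (j + 1) =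
      cyclesMod Ψ (⊥ : Ideal (MvPolynomial V k)) (rfl : i + 1 = i + 1) (j + 1) := by
    refine le_antisymm (boundariesMod_le_cyclesMod _ _ _) fun z hz => ?_
    rw [mem_cyclesMod, Submodule.bot_smul, Submodule.mem_bot] at hz
    exact mem_boundariesMod.2 ⟨hz.1, Submodule.mem_sup_left
      (mem_range_partitionD (sub_add_cancel i 1).symm rfl j.succ_pos hz.1 hz.2)⟩
  rw [h2] at h1
  omega

end DegreeZero

/-! ### The dimensions of the homology of the reduced partition complex -/

section Main

open RingTheory.Sequence

variable {k : Type w} [Field k] {V : Type u} [LinearOrder V] {Ψ : RelativeComplex V}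

/-- Homology at `i + 1` is defined with source `i + 1 - 1`, which is equal to `i` but not by
definition. -/
theorem boundariesMod_congr {J : Ideal (MvPolynomial V k)} {p p' q : ℤ} (h : q = p + 1)
    (h' : q = p' + 1) (j : ℕ) : boundariesMod Ψ J h j = boundariesMod Ψ J h' j := by
  obtain rfl : p = p' := by omega
  rfl

theorem finrank_cohomology_congr {a b : ℤ} (h : a = b) :
    Module.finrank k (Cohomology k Ψ a) = Module.finrank k (Cohomology k Ψ b) := by
  rw [h]

theorem IsGradedOn.finrank_reducedPartitionHomologyPiece_sup [Finite V]
    {J : Ideal (MvPolynomial V k)} (hJ : IsGradedOn Ψ J) {θ : MvPolynomial V k}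
    (hθ : θ.IsHomogeneous 1) {i : ℤ}
    (h₁ : ∀ x : PartitionTerm k Ψ (i + 1),
      θ • x ∈ (J • ⊤ : Submodule (MvPolynomial V k) (PartitionTerm k Ψ (i + 1))) →
      x ∈ (J • ⊤ : Submodule (MvPolynomial V k) (PartitionTerm k Ψ (i + 1))))
    (h₂ : ∀ x : PartitionTerm k Ψ (i + 1 + 1),
      θ • x ∈ (J • ⊤ : Submodule (MvPolynomial V k) (PartitionTerm k Ψ (i + 1 + 1))) →
      x ∈ (J • ⊤ : Submodule (MvPolynomial V k) (PartitionTerm k Ψ (i + 1 + 1)))) (j : ℕ) :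
    Module.finrank k (reducedPartitionHomologyPiece Ψ (J ⊔ Ideal.span {θ}) i (j + 1)) =
      Module.finrank k (reducedPartitionHomologyPiece Ψ J i (j + 1)) +
        Module.finrank k (reducedPartitionHomologyPiece Ψ J (i + 1) j) := by
  have e := finrank_reducedPartitionHomologyPiece_add (Ψ := Ψ) (J := J ⊔ Ideal.span {θ}) i (j + 1)
  have e₀ := finrank_reducedPartitionHomologyPiece_add (Ψ := Ψ) (J := J) i (j + 1)
  have e₁ := finrank_reducedPartitionHomologyPiece_add (Ψ := Ψ) (J := J) (i + 1) j
  have e₂ := hJ.finrank_cyclesMod_sup hθ (sub_add_cancel i 1).symm (rfl : i + 1 = i + 1)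
    (rfl : i + 1 + 1 = i + 1 + 1) h₁ h₂ j
  rw [boundariesMod_congr _ (rfl : i + 1 = i + 1)] at e₁
  generalize Module.finrank k (reducedPartitionHomologyPiece Ψ (J ⊔ Ideal.span {θ}) i (j + 1)) = a
    at e ⊢
  generalize Module.finrank k (reducedPartitionHomologyPiece Ψ J i (j + 1)) = a₀ at e₀ ⊢
  generalize Module.finrank k (reducedPartitionHomologyPiece Ψ J (i + 1) j) = a₁ at e₁ ⊢
  rw [← e, ← e₀, ← e₁] at e₂
  omega

theorem IsGradedOn.finrank_reducedPartitionHomologyPiece_sup_zero [Finite V]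
    {J : Ideal (MvPolynomial V k)} (hJ : IsGradedOn Ψ J) {θ : MvPolynomial V k}
    (hθ : θ.IsHomogeneous 1) (i : ℤ) :
    Module.finrank k (reducedPartitionHomologyPiece Ψ (J ⊔ Ideal.span {θ}) i 0) =
      Module.finrank k (reducedPartitionHomologyPiece Ψ J i 0) := by
  have e := finrank_reducedPartitionHomologyPiece_add (Ψ := Ψ) (J := J ⊔ Ideal.span {θ}) i 0
  rw [hJ.cyclesMod_sup_zero hθ, hJ.boundariesMod_sup_zero hθ,
    ← finrank_reducedPartitionHomologyPiece_add (Ψ := Ψ) (J := J) i 0] at e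
  exact Nat.add_right_cancel e

theorem eq_choose_succ_mul {a b c m s j : ℕ} (h : m = a + b) (ha : a = s.choose (j + 1) * c)
    (hb : b = s.choose j * c) : m = (s + 1).choose (j + 1) * c := by
  rw [h, ha, hb, Nat.choose_succ_succ, add_mul, add_comm]

/-- Induction on the number of forms: no forms leave only degree zero, and each further form
contributes one application of Pascal's rule. The step at `i` uses injectivity in degrees `i + 1`
and `i + 2`, which are nonnegative because `i ≥ -1`. -/
theorem finrank_reducedPartitionHomologyPiece_take [Fintype V] {rs : List (MvPolynomial V k)}
    (hrs : ∀ f ∈ rs, f.IsHomogeneous 1)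
    (h : ∀ τ ∈ Ψ.Δ, τ.Nonempty → IsWeaklyRegular (FaceModule k (Ψ.star τ)) rs) {s : ℕ}
    (hs : s ≤ rs.length) :
    IsGradedOn Ψ (Ideal.ofList (rs.take s)) ∧ ∀ (i : ℤ) (j : ℕ), -1 ≤ i →
      Module.finrank k (reducedPartitionHomologyPiece Ψ (Ideal.ofList (rs.take s)) i j) =
        s.choose j * Module.finrank k (Cohomology k Ψ (i + j)) := by
  induction s with
  | zero =>
    rw [List.take_zero, Ideal.ofList_nil]
    refine ⟨isGradedOn_bot, fun i j _ => ?_⟩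
    cases j with
    | zero =>
      rw [finrank_reducedPartitionHomologyPiece_bot_zero, Nat.choose_zero_right, one_mul,
        Nat.cast_zero, add_zero]
    | succ j =>
      rw [finrank_reducedPartitionHomologyPiece_bot_succ, Nat.choose_zero_succ, zero_mul]
  | succ s ih =>
    obtain ⟨hgr, ih⟩ := ih (Nat.le_of_succ_le hs)
    have hs' : s < rs.length := hs
    have hJ : Ideal.ofList (rs.take (s + 1)) =
        Ideal.ofList (rs.take s) ⊔ Ideal.span {rs[s]} := by
      rw [List.take_succ_eq_append_getElem hs', Ideal.ofList_append, Ideal.ofList_singleton]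
    have hθ : (rs[s]).IsHomogeneous 1 := hrs _ (List.getElem_mem hs')
    rw [hJ]
    refine ⟨hgr.sup hθ, fun i j hi => ?_⟩
    cases j with
    | zero =>
      have h0 := ih i 0 hi
      rw [Nat.choose_zero_right] at h0 ⊢
      exact (hgr.finrank_reducedPartitionHomologyPiece_sup_zero hθ i).trans h0
    | succ j =>
      have hc : i + 1 + (j : ℤ) = i + ((j + 1 : ℕ) : ℤ) := by push_cast; ring
      have h1 := ih (i + 1) j (by omega)
      rw [finrank_cohomology_congr hc] at h1
      exact eq_choose_succ_mul (hgr.finrank_reducedPartitionHomologyPiece_sup hθ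
        (partition_smul_mem_imp h hs' (by omega)) (partition_smul_mem_imp h hs' (by omega)) j)
        (ih i (j + 1) hi) h1

/-! ### The term `P^{-1}` and the kernel of the map to the vertex stars. -/

theorem RelativeComplex.le_star_empty_Δ (Ψ : RelativeComplex V) : Ψ.Δ ≤ (Ψ.star ∅).Δ :=
  fun ρ hρ => ⟨hρ, by rw [Finset.empty_union]; exact hρ⟩

theorem RelativeComplex.le_star_empty_Γ (Ψ : RelativeComplex V) : Ψ.Γ ≤ (Ψ.star ∅).Γ :=
  fun ρ hρ => ⟨hρ, by rw [Finset.empty_union]; exact hρ⟩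

/-- The isomorphism of the term `P^{-1}` of the partition complex with `k[Ψ]`. -/
def partitionTermEquiv (k : Type w) [Field k] (Ψ : RelativeComplex V) (h : ∅ ∈ Ψ.Δ) :
    PartitionTerm k Ψ (-1) ≃ₗ[MvPolynomial V k] FaceModule k Ψ :=
  LinearEquiv.ofLinearMap
    ((restrictFaceModule k Ψ.le_star_empty_Δ Ψ.le_star_empty_Γ).comp
      (LinearMap.proj (⟨∅, h, by simp⟩ : Ψ.AmbientFace (-1))))
    (LinearMap.pi fun τ => restrictFaceModule k (Ψ.star_Δ_le_self τ.1) (Ψ.star_Γ_le_self τ.1))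
    (by
      ext x
      obtain ⟨f, hf, rfl⟩ := FaceModule.exists_mk x
      rfl)
    (by
      ext z τ
      obtain ⟨F, hF, rfl⟩ := exists_partitionMk z
      obtain ⟨τ, hτ, hcard⟩ := τ
      obtain rfl : τ = ∅ := by
        rw [← Finset.card_eq_zero]
        omega
      rfl)

theorem partitionTermEquiv_mk {h : ∅ ∈ Ψ.Δ} {F : Finset V → MvPolynomial V k} (hF : IsRep Ψ F) :
    partitionTermEquiv k Ψ h (partitionMk (-1) F hF) =
      FaceModule.mk k Ψ (F ∅) (nonfaceIdeal_antitone k Ψ.le_star_empty_Γ (hF ∅)) := rfl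

theorem partitionTermEquiv_apply {h : ∅ ∈ Ψ.Δ} (z : PartitionTerm k Ψ (-1)) :
    partitionTermEquiv k Ψ h z = restrictFaceModule k Ψ.le_star_empty_Δ Ψ.le_star_empty_Γ
      (z (⟨∅, h, by simp⟩ : Ψ.AmbientFace (-1))) := rfl

theorem mem_partitionPiece_iff {h : ∅ ∈ Ψ.Δ} {j : ℕ} {z : PartitionTerm k Ψ (-1)} :
    z ∈ partitionPiece k Ψ (-1) j ↔ partitionTermEquiv k Ψ h z ∈ faceModulePiece k Ψ j := by
  constructor
  · intro hz
    obtain ⟨f, hf, hhom, hzf⟩ :=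
      FaceModule.mem_faceModulePiece_iff.1 (hz (⟨∅, h, by simp⟩ : Ψ.AmbientFace (-1)) trivial)
    refine FaceModule.mem_faceModulePiece_iff.2 ⟨f, nonfaceIdeal_antitone k
      (Ψ.le_star_empty_Γ) hf, hhom, ?_⟩
    rw [partitionTermEquiv_apply, hzf]
    rfl
  · intro hz τ _
    obtain ⟨f, hf, hhom, hzf⟩ := FaceModule.mem_faceModulePiece_iff.1 hz
    rw [← (partitionTermEquiv k Ψ h).symm_apply_apply z, hzf]
    exact FaceModule.mem_faceModulePiece_iff.2
      ⟨f, nonfaceIdeal_antitone k (Ψ.star_Γ_le_self τ.1) hf, hhom, rfl⟩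

theorem mem_smul_top_iff_of_equiv {R M N : Type*} [CommRing R] [AddCommGroup M] [Module R M]
    [AddCommGroup N] [Module R N] (e : M ≃ₗ[R] N) (J : Ideal R) (x : M) :
    e x ∈ (J • ⊤ : Submodule R N) ↔ x ∈ (J • ⊤ : Submodule R M) := by
  refine ⟨fun h => ?_, fun h => Submodule.smul_top_le_comap_smul_top J e.toLinearMap h⟩
  have := Submodule.smul_top_le_comap_smul_top J e.symm.toLinearMap h
  simpa using this

theorem partitionD_neg_one_apply {h : ∅ ∈ Ψ.Δ} (z : PartitionTerm k Ψ (-1)) {q : ℤ}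
    (hq : q = -1 + 1) (v : V)
    (hv : ({v} : Finset V) ∈ Ψ.Δ ∧ ((({v} : Finset V).card : ℤ) - 1 = q)) :
    partitionD k Ψ hq z ⟨{v}, hv⟩ =
      restrictFaceModule k (Ψ.star_Δ_le_self {v}) (Ψ.star_Γ_le_self {v})
        (partitionTermEquiv k Ψ h z) := by
  obtain ⟨F, hF, rfl⟩ := exists_partitionMk z
  have h1 : simplexD F {v} = F ∅ := by
    rw [simplexD, Finset.sum_singleton, vertexSign, Finset.filter_singleton,
      if_neg (lt_irrefl v), Finset.erase_singleton]
    simp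
  rw [partitionTermEquiv_mk, FaceModule.restrict_mk, partitionD_mk]
  refine FaceModule.mk_eq_mk_iff.2 ?_
  rw [h1, sub_self]
  exact zero_mem _

theorem partitionD_neg_one_mem_iff [Finite V] (h : ∅ ∈ Ψ.Δ) (J : Ideal (MvPolynomial V k))
    {q : ℤ} (hq : q = -1 + 1) (z : PartitionTerm k Ψ (-1)) :
    partitionD k Ψ hq z ∈
        (J • ⊤ : Submodule (MvPolynomial V k) (PartitionTerm k Ψ q)) ↔
      ∀ v : Ψ.Vertex, restrictFaceModule k (Ψ.star_Δ_le_self {v.1}) (Ψ.star_Γ_le_self {v.1})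
        (partitionTermEquiv k Ψ h z) ∈
        (J • ⊤ : Submodule (MvPolynomial V k) (FaceModule k (Ψ.star {v.1}))) := by
  have := Finite.of_injective (fun τ : Ψ.AmbientFace q => τ.1) Subtype.val_injective
  rw [mem_smul_top_pi_iff]
  constructor
  · intro hz v
    have hv := hz ⟨{v.1}, v.2, by simp [hq]⟩
    rwa [partitionD_neg_one_apply (h := h)] at hv
  · rintro hz ⟨τ, hτ, hcard⟩
    obtain ⟨v, rfl⟩ : ∃ v, τ = {v} := Finset.card_eq_one.1 (by omega)
    rw [partitionD_neg_one_apply (h := h) z hq v ⟨hτ, hcard⟩]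
    exact hz ⟨v, hτ⟩

/-- The differential out of `P^{-1}` is the restriction to the vertex stars, all signs being `+1`,
and nothing but `J P^{-1}` is a boundary modulo `J`. Hence the kernel is the homology at `-1`. -/
theorem finrank_vertexStarKernel [Finite V] (h : ∅ ∈ Ψ.Δ) (J : Ideal (MvPolynomial V k)) (j : ℕ) :
    Module.finrank k (vertexStarKernel Ψ J j) =
      Module.finrank k (reducedPartitionHomologyPiece Ψ J (-1) j) := by
  have h1 := finrank_reducedPartitionHomologyPiece_add (Ψ := Ψ) (J := J) (-1) j
  set e := partitionTermEquiv k Ψ h with he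
  have hmem : ∀ x : FaceModule k Ψ,
      vertexStarMap Ψ J (Submodule.Quotient.mk x) = 0 ↔
        ∀ v : Ψ.Vertex, restrictFaceModule k (Ψ.star_Δ_le_self {v.1}) (Ψ.star_Γ_le_self {v.1}) x ∈
          (J • ⊤ : Submodule (MvPolynomial V k) (FaceModule k (Ψ.star {v.1}))) := by
    intro x
    rw [funext_iff]
    exact forall_congr' fun v => Submodule.Quotient.mk_eq_zero _
  let φ : cyclesMod Ψ J (rfl : (-1 : ℤ) + 1 = -1 + 1) j →ₗ[k] Reduced J (FaceModule k Ψ) :=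
    ((J • ⊤ : Submodule (MvPolynomial V k) (FaceModule k Ψ)).mkQ.restrictScalars k).comp
      ((e.toLinearMap.restrictScalars k).comp (Submodule.subtype _))
  have h2 := φ.finrank_range_add_finrank_ker
  have hrange : LinearMap.range φ = vertexStarKernel Ψ J j := by
    ext x
    constructor
    · rintro ⟨z, rfl⟩
      refine ⟨(hmem _).2 ((partitionD_neg_one_mem_iff h J rfl z.1).1 z.2.2), e z.1,
        mem_partitionPiece_iff.1 z.2.1, rfl⟩
    · rintro ⟨hx, y, hy, rfl⟩
      refine ⟨⟨e.symm y, mem_partitionPiece_iff.2 (by rwa [← he, e.apply_symm_apply]),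
        (partitionD_neg_one_mem_iff h J rfl _).2 ?_⟩, ?_⟩
      · rw [← he, e.apply_symm_apply]
        exact (hmem y).1 hx
      · exact congrArg _ (e.apply_symm_apply y)
  have hker : LinearMap.ker φ = (boundariesMod Ψ J (sub_add_cancel (-1 : ℤ) 1).symm j).submoduleOf
      (cyclesMod Ψ J (rfl : (-1 : ℤ) + 1 = -1 + 1) j) := by
    ext z
    have h3 : φ z = 0 ↔ e z.1 ∈ (J • ⊤ : Submodule (MvPolynomial V k) (FaceModule k Ψ)) :=
      Submodule.Quotient.mk_eq_zero _
    rw [LinearMap.mem_ker, h3, mem_smul_top_iff_of_equiv]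
    refine ⟨fun hz => ⟨z.2.1, Submodule.mem_sup_right hz⟩, fun hz => ?_⟩
    obtain ⟨y, hy⟩ := mem_range_sup_iff.1 (mem_boundariesMod.1 hz).2
    -- There are no faces of dimension `-2`, so the preceding term of the complex is zero.
    have hy0 : y = 0 := by
      ext τ
      have := τ.2.2
      omega
    rwa [hy0, map_zero, sub_zero] at hy
  rw [hrange, hker, (Submodule.submoduleOfEquivOfLe
    (boundariesMod_le_cyclesMod (sub_add_cancel (-1 : ℤ) 1).symm rfl j)).finrank_eq] at h2
  omega

end Main

end PartitionOfUnity

end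

open PartitionOfUnity
theorem mainTheorem2 {k : Type*} [Field k] [Infinite k] {V : Type*} [Fintype V] [LinearOrder V]
    (Ψ : RelativeComplex V) (d : ℤ) (n : ℕ) (hn : (n : ℤ) = d + 1) (hpure : Ψ.IsPureOfDim d)
    (hCM : ∀ τ ∈ Ψ.Δ, τ.Nonempty → IsCohenMacaulay k (V := V) (FaceModule k (Ψ.star τ))) :
    HoldsGenerically fun c : Fin n × Ψ.Vertex → k =>
      (∀ (i : ℤ) (j : ℕ), -1 ≤ i →
        Module.finrank k (reducedPartitionHomologyPiece Ψ (linearFormsIdeal Ψ c) i j) =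
          n.choose j * Module.finrank k (Cohomology k Ψ (i + j))) ∧
      ∀ j : ℕ, Module.finrank k (vertexStarKernel Ψ (linearFormsIdeal Ψ c) j) =
        n.choose j * Module.finrank k (Cohomology k Ψ ((j : ℤ) - 1)) := by
  obtain ⟨P, hP, hgen⟩ := holdsGenerically_restrictsToBases (k := k) Ψ n
  refine ⟨P, hP, fun c hc => ?_⟩
  have hideal : Ideal.ofList ((List.ofFn (linearForm Ψ c)).take n) = linearFormsIdeal Ψ c := by
    rw [List.take_of_length_le List.length_ofFn.le, Ideal.ofList, linearFormsIdeal]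
    congr 1
    ext f
    exact List.mem_ofFn
  have hmain := (finrank_reducedPartitionHomologyPiece_take (Ψ := Ψ)
    (rs := List.ofFn (linearForm Ψ c)) (fun f hf => by
      obtain ⟨t, rfl⟩ := List.mem_ofFn.1 hf
      exact isHomogeneous_linearForm Ψ c t)
    (fun τ hτ hne => isWeaklyRegular_linearForm hn hpure hCM (hgen c hc) hτ hne)
    (s := n) List.length_ofFn.ge).2
  rw [hideal] at hmain
  refine ⟨hmain, fun j => ?_⟩
  -- Purity provides a face, hence `∅ ∈ Δ`, so that `P^{-1}` is a copy of `k[Ψ]`.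
  obtain ⟨σ, hσ⟩ := hpure.1
  rw [finrank_vertexStarKernel (Ψ.Δ.lower (Finset.empty_subset σ) hσ.1), hmain (-1) j le_rfl,
    neg_add_eq_sub]
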